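/- **Model.** A base station serves $n$ sources that are split into $\eta\ge 1$ groups. Group $g$ has $n_g=\alpha_g n$ sources, where the $\alpha_g>0$ are rational and $\sum_g\alpha_g=1$; $n\to\infty$ is taken through the $n$ for which all $\alpha_g n$ are integers. Let $1=d_1<d_2<\dots<d_\eta$ be integers and $b>0$. The $k$-th packet $(g,i,k)$ of source $i$ of group $g$ arrives at time $S_{g,i}(k)=(k-1)d_g nb$ ($k\ge1$; put $S_{g,i}(0)=-d_g nb$) and is stored in an infinite first-come-first-served queue of this source (infinite packet queueing, IPQ). The transmission times $V_{g,i}(k)\ge 0$ are i.i.d. with law $\nu$, and $\Lambda(\theta)=\log\mathbb E\,e^{\theta V}$ is finite for some $\theta>0$. Generalized round robin (GRR) works in rounds $r=0,1,2,\dots$. In round $r$ the groups $g$ with $d_g\mid r$ are served in increasing order of $g$, and within such a group the sources $1,\dots,n_g$ are served in this (cyclic) order, one packet each; the packet served for a source of group $g$ is its $(r/d_g+1)$-th one. The station transmits one packet at a time, and starts each transmission as soon as the previous packet has departed and the scheduled packet has arrived. Let $D_{g,i}(k)$ be the departure time of packet $(g,i,k)$ and $A_{g,i}(k)=D_{g,i}(k)-S_{g,i}(k-1)$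 its peak age. **Notation.** Let $\tilde d=\mathrm{lcm}(d_1,\dots,d_\eta)$, $k'=\lceil d_g(k-1)/\tilde d\,\rceil$ and $C=\sum_{j=1}^{\eta}\frac{\tilde d}{d_j}\alpha_j$. Let $m_{g,i}(k)=m^{(n)}_{g,i}(k)$ be $1/n$ times the number of packets transmitted in round $d_g(k-1)$ up to and including $(g,i,k)$, and let $m=\sum_{j<g,\ d_j\mid d_g(k-1)}\alpha_j$. For $c,y\in\mathbb R$ let $I_c(y)=\sup_\theta\{\theta y-c\Lambda(\theta)\}\in[-\infty,\infty]$, the supremum being over all $\theta>0$ with $\Lambda(\theta)<\infty$. Put $$\gamma^{(U,0)}_{g,i}(x,k,\infty)=\gamma^{(L,0)}_{g,i}(x,k,\infty)=I_m(x-d_gb),$$ and, for $\ell'\ge1$, $$\gamma^{(U,\ell')}_{g,i}(x,k,\infty)=\ell'\, I_{C+\frac{m}{\ell'}}\Big(\tfrac{x}{\ell'}+\tfrac{(\ell'-1)\tilde d-d_g}{\ell'}b\Big),\qquad \gamma^{(L,\ell')}_{g,i}(x,k,\infty)=\ell'\, I_{\frac{(\ell'-1)C}{\ell'}+\frac{m}{\ell'}}\Big(\tfrac{x}{\ell'}+\tfrac{\ell'\tilde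 d-d_g}{\ell'}b\Big).$$ **Statement.** Fix a source $(g,i)$, $k\ge1$ and $x>0$, and let $\rho_n=-\frac1n\log\Pr(A_{g,i}(k)\ge nx)\in[0,\infty]$. Then, as $n\to\infty$, $m^{(n)}_{g,i}(k)\to m$ and $$\min_{0\le\ell'\le k'}\gamma^{(U,\ell')}_{g,i}(x,k,\infty)\ \le\ \liminf_{n\to\infty}\rho_n\ \le\ \min_{0\le\ell'\le k'}\gamma^{(L,\ell')}_{g,i}(x,k,\infty).$$ In particular, whenever the asymptotic decay rate $\lim_n\rho_n$ exists, it lies between these two minima. Moreover $$\limsup_{n\to\infty}\rho_n\ \le\ \min_{0\le\ell'\le k'}\gamma^{(L,\ell')}_{g,i}(x,k,\infty)$$ if $g\ge2$, and also if $g=1$ provided that $\lim_{t\to\infty}-\frac1t\log\Pr(V\ge t)$ exists in $[0,\infty]$ (which is so if $\Lambda$ is finite on all of $(0,\infty)$, or if $V$ is, for instance, exponential or geometric). -/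

import Mathlib

open MeasureTheory ProbabilityTheory Filter Topology

/-!  A base station serves `n` sources, split into `η` groups.  Group `g : Fin η` holds
`α g * n` sources, whose packets arrive every `d g * n * b` units of time, in a batch.
A packet is a triple `(g, i, k)`: the `k`-th packet of the `i`-th source of group `g`, where
`i` and `k` are counted from `1`. -/

namespace GRR

/-- Packets `(g, i, k)`; sources and updates are counted from `1`. -/
abbrev Packet (η : ℕ) : Type := Fin η × ℕ × ℕ

/-- The numbers `n` of sources for which each group has an integral number `α g * n` of sources. -/
def admissible {η : ℕ} (α : Fin η → ℚ) : Set ℕ :=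
  {n | ∀ g, ∃ N : ℕ, (N : ℚ) = α g * n}

/-- The limit `n → ∞`, through the admissible numbers of sources. -/
def manySources {η : ℕ} (α : Fin η → ℚ) : Filter ℕ :=
  atTop ⊓ 𝓟 (admissible α)

/-- The number `n_g = α_g n` of sources in group `g` (the floor is void for admissible `n`). -/
def groupSize {η : ℕ} (α : Fin η → ℚ) (n : ℕ) (g : Fin η) : ℕ :=
  ⌊α g * n⌋₊

/-- The arrival (generation) time of the `k`-th packet of every source of group `g`.  The first
packets arrive at time `0`; for `k = 0` this is the fictitious time one period earlier. -/
noncomputable def arrivalTime {η : ℕ} (d : Fin η → ℕ) (b : ℝ) (n : ℕ) (g : Fin η) (k : ℕ) : ℝ :=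
  ((k : ℝ) - 1) * (d g * (n * b))

/-- The packets that generalized round robin transmits in round `r = 0, 1, 2, …`, in order of
transmission: the groups `g` with `r % d g = 0` are served in increasing order, and round robin
serves the sources of a group cyclically, `1, 2, …, N g` (the next source is always the one idle
for longest; at the start, when all are equally idle, the order is by index).  The packet served for a source of
group `g` is the oldest one not yet served, with number `r / d g + 1`. -/
def roundPackets {η : ℕ} (d : Fin η → ℕ) (N : Fin η → ℕ) (r : ℕ) : List (Packet η) :=
  ((List.finRange η).filter fun g => r % d g = 0).flatMap fun g =>
    (List.range (N g)).map fun i => (g, i + 1, r / d g + 1)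

/-- The round, counted from `0`, in which the `k`-th packets of group `g` are transmitted. -/
def roundOf {η : ℕ} (d : Fin η → ℕ) (p : Packet η) : ℕ :=
  d p.1 * (p.2.2 - 1)

/-- The packets transmitted in the round of `p`, from the first one of the round through `p`
itself, in order of transmission. -/
def roundUpTo {η : ℕ} (d : Fin η → ℕ) (N : Fin η → ℕ) (p : Packet η) : List (Packet η) :=
  ((roundPackets d N (roundOf d p)).takeWhile fun q => q ≠ p) ++ [p]

/-- All packets transmitted through `p`, in order of transmission. -/
def servedUpTo {η : ℕ} (d : Fin η → ℕ) (N : Fin η → ℕ) (p : Packet η) : List (Packet η) :=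
  ((List.range (roundOf d p)).flatMap (roundPackets d N)) ++ roundUpTo d N p

/-- The time at which the base station has transmitted the packets of the list `L`, in this order.
The transmission of `q` starts when the previous packet has departed and `q` has arrived
(the base station waits for the scheduled packet), and it lasts `v q`. -/
noncomputable def completionTime {η : ℕ} (d : Fin η → ℕ) (b : ℝ) (n : ℕ) (v : Packet η → ℝ)
    (L : List (Packet η)) : ℝ :=
  L.foldl (fun t q => max t (arrivalTime d b n q.1 q.2.2) + v q) 0

/-- The departure time `D_{g,i}(k)` of the packet `p = (g, i, k)` under generalized round robin
with infinite first-come-first-served queues, if the transmission times are `v`. -/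
noncomputable def departureTime {η : ℕ} (d : Fin η → ℕ) (α : Fin η → ℚ) (b : ℝ) (n : ℕ)
    (v : Packet η → ℝ) (p : Packet η) : ℝ :=
  completionTime d b n v (servedUpTo d (groupSize α n) p)

/-- The peak age `A_{g,i}(k) = D_{g,i}(k) - S_{g,i}(k - 1)` of the packet `p = (g, i, k)`. -/
noncomputable def peakAge {η : ℕ} (d : Fin η → ℕ) (α : Fin η → ℚ) (b : ℝ) (n : ℕ)
    (v : Packet η → ℝ) (p : Packet η) : ℝ :=
  departureTime d α b n v p - arrivalTime d b n p.1 (p.2.2 - 1)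

/-- `-(1/n) log Pr(A ≥ n x)`, in the extended reals (it is `+∞` if the probability is `0`). -/
noncomputable def decayRate {η : ℕ} {Ω : Type*} [MeasurableSpace Ω] (P : Measure Ω)
    (V : Packet η → Ω → ℝ) (d : Fin η → ℕ) (α : Fin η → ℚ) (b : ℝ) (p : Packet η) (x : ℝ)
    (n : ℕ) : EReal :=
  -(ENNReal.log (P {ω | n * x ≤ peakAge d α b n (fun q => V q ω) p}) / (n : EReal))

/-- `m_{g,i}(k)`: the number of packets transmitted in the round of `p = (g, i, k)` from its
first packet through `p`, divided by `n`. -/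
noncomputable def roundRatio {η : ℕ} (d : Fin η → ℕ) (α : Fin η → ℚ) (p : Packet η) (n : ℕ) : ℝ :=
  ((roundUpTo d (groupSize α n) p).length : ℝ) / n

/-- The value of `m_{g,i}(k)` at `n = ∞`: the fraction of the sources that lie in the groups
served before group `g` in the round of `p = (g, i, k)`. -/
noncomputable def limitRatio {η : ℕ} (d : Fin η → ℕ) (α : Fin η → ℚ) (p : Packet η) : ℝ :=
  ∑ j with j < p.1 ∧ roundOf d p % d j = 0, (α j : ℝ)

/-- `d̃`, the number of rounds in an iteration. -/
def iterLength {η : ℕ} (d : Fin η → ℕ) : ℕ :=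
  Finset.univ.lcm d

/-- `∑ j, (d̃ / d_j) α_j`, the number of packets per iteration, divided by `n`. -/
noncomputable def iterLoad {η : ℕ} (d : Fin η → ℕ) (α : Fin η → ℚ) : ℝ :=
  ∑ j, (iterLength d : ℝ) / d j * α j

/-- `k' = ⌈(k̃ - 1) / d̃⌉`, where `k̃ = d_g (k - 1) + 1`. -/
noncomputable def lastIter {η : ℕ} (d : Fin η → ℕ) (p : Packet η) : ℕ :=
  ⌈(roundOf d p : ℝ) / iterLength d⌉₊

/-- `sup_θ {θ y - c Λ(θ)}`, over the `θ > 0` where `Λ(θ) = log ∫ exp (θ v) dν(v)` is finite. -/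
noncomputable def rateFunction (ν : Measure ℝ) (c y : ℝ) : EReal :=
  ⨆ θ ∈ {θ : ℝ | 0 < θ ∧ θ ∈ integrableExpSet id ν},
    ((θ * y - c * cgf id ν θ : ℝ) : EReal)

/-- `γ^{(U,ℓ)}_{g,i}(x, k, ·)`, with `m` for `m_{g,i}(k)`. -/
noncomputable def gammaU {η : ℕ} (ν : Measure ℝ) (d : Fin η → ℕ) (α : Fin η → ℚ) (b : ℝ)
    (g : Fin η) (m x : ℝ) (l : ℕ) : EReal :=
  if l = 0 then rateFunction ν m (x - d g * b)
  else ((l : ℝ) : EReal) * rateFunction ν (iterLoad d α + m / l)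
    (x / l + (((l : ℝ) - 1) * iterLength d - d g) / l * b)

/-- `γ^{(L,ℓ)}_{g,i}(x, k, ·)`, with `m` for `m_{g,i}(k)`. -/
noncomputable def gammaL {η : ℕ} (ν : Measure ℝ) (d : Fin η → ℕ) (α : Fin η → ℚ) (b : ℝ)
    (g : Fin η) (m x : ℝ) (l : ℕ) : EReal :=
  if l = 0 then rateFunction ν m (x - d g * b)
  else ((l : ℝ) : EReal) * rateFunction ν (((l : ℝ) - 1) * iterLoad d α / l + m / l)
    (x / l + ((l : ℝ) * iterLength d - d g) / l * b)

end GRR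

/-! All packets of round r arrive at the same time r·nb, so unrolling the recursion for the
departure times gives a maximum over rounds only. With R the round of p = (g,i,k), the departure
time is the maximum over r ≤ R of r·nb plus the transmission times of all packets from the start of
round r through p (`completionTime_servedUpTo_le`, `le_completionTime_servedUpTo`). Hence, up to
null sets, {A ≥ nx} is the union over r ≤ R of the events that this sum is at least n·y_r, where y_r
= x + (R - r)b - d_g b. The sum has exactly c_r n + i terms, where c_r is m plus the load of the
rounds r, …, R-1, and the number R+1 of events does not depend on n.

A union bound and Chernoff's inequality then bound the liminf of the decay rate below by the minimum
of I_{c_r}(y_r). Conversely each single event bounds the probability from below, and Cramér's lower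
bound gives limsup ≤ I_{c_r}(y_r) whenever c_r > 0.

The γ's arise from coarsening r to whole iterations: any d̃ consecutive rounds carry load C, and
I_c(y) decreases in c and increases in y since Λ ≥ 0 on (0,∞). Rounding R - r up to ℓ' iterations in
the load and down to ℓ'-1 in the time gives γ^U (`exists_gammaU_le`); the opposite rounding gives
γ^L (`exists_le_gammaL`).

The exception is c_r = 0, which happens for the first group with r = R: only i packets remain and
Cramér's theorem says nothing. There I_0(y) is, for y > 0, y times the supremum of the θ with Λ(θ) <
∞, and the tail of a single transmission time is used. A tail that decays too fast along an
arithmetic progression would make Λ finite beyond that supremum. This settles the liminf; the limsup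
needs the tail to have a decay rate. -/

namespace GRR

/-! ### Cramér's lower bound, from three values of the moment generating function -/

/-- A lower bound on the probability that a sum of `N` independent variables is nonnegative, in
terms of three values of the moment generating function. -/
theorem pow_mgf_sub_le_pi_sum_nonneg (μ : Measure ℝ) [IsFiniteMeasure μ]
    {θ δ κ : ℝ} (hθ : 0 ≤ θ) (hδ : 0 ≤ δ)
    (h0 : θ ∈ integrableExpSet id μ) (h1 : θ - δ ∈ integrableExpSet id μ)
    (h2 : θ + δ ∈ integrableExpSet id μ) (N : ℕ) :
    mgf id μ θ ^ N - mgf id μ (θ - δ) ^ N - Real.exp (-(κ * δ * N)) * mgf id μ (θ + δ) ^ N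
      ≤ Real.exp (θ * κ * N) *
        (Measure.pi fun _ : Fin N => μ).real {x | 0 ≤ ∑ i, x i} := by
  set π := Measure.pi fun _ : Fin N => μ
  have hint : ∀ t, t ∈ integrableExpSet id μ →
      Integrable (fun x : Fin N → ℝ => Real.exp (t * ∑ i, x i)) π := by
    intro t ht
    simp_rw [Finset.mul_sum, Real.exp_sum]
    exact Integrable.fintype_prod (f := fun _ : Fin N => fun y : ℝ => Real.exp (t * y))
      (fun _ => ht)
  have hval : ∀ t, ∫ x : Fin N → ℝ, Real.exp (t * ∑ i, x i) ∂π = mgf id μ t ^ N := by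
    intro t
    simp_rw [Finset.mul_sum, Real.exp_sum]
    have := integral_fintype_prod_eq_pow (ι := Fin N) (μ := μ) (fun y : ℝ => Real.exp (t * y))
    simpa [mgf] using this
  have hmeas : MeasurableSet {x : Fin N → ℝ | 0 ≤ ∑ i, x i} :=
    measurableSet_le measurable_const (by fun_prop)
  -- A pointwise bound of exp (θ S), integrated. The three terms on the right dominate it for 0 ≤ S
  -- ≤ κN, for S < 0 and for S > κN respectively. This concentration estimate takes the place of an
  -- exponential change of measure and a law of large numbers.
  have key : ∫ x : Fin N → ℝ, Real.exp (θ * ∑ i, x i) ∂π ≤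
      ∫ x : Fin N → ℝ, (({x : Fin N → ℝ | 0 ≤ ∑ i, x i}.indicator
        (fun _ => Real.exp (θ * κ * N)) x + Real.exp ((θ - δ) * ∑ i, x i))
        + Real.exp (-(κ * δ * N)) * Real.exp ((θ + δ) * ∑ i, x i)) ∂π := by
    apply integral_mono (hint _ h0)
    · exact (((integrable_const _).indicator hmeas).add (hint _ h1)).add
        ((hint _ h2).const_mul _)
    · intro x
      dsimp only
      set S := ∑ i, x i
      by_cases hS : 0 ≤ S
      · rw [Set.indicator_of_mem (by exact hS)]
        by_cases hS' : S ≤ κ * N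
        · have : Real.exp (θ * S) ≤ Real.exp (θ * κ * N) :=
            Real.exp_le_exp.2 (by rw [mul_assoc]; exact mul_le_mul_of_nonneg_left hS' hθ)
          have h1 := mul_pos (Real.exp_pos (-(κ * δ * N))) (Real.exp_pos ((θ + δ) * S))
          linarith [Real.exp_pos ((θ - δ) * S)]
        · rw [← Real.exp_add]
          have : Real.exp (θ * S) ≤ Real.exp (-(κ * δ * N) + (θ + δ) * S) :=
            Real.exp_le_exp.2 (by nlinarith [mul_nonneg hδ (sub_nonneg.2 (not_le.1 hS').le)])
          linarith [Real.exp_pos (θ * κ * N), Real.exp_pos ((θ - δ) * S)]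
      · have : Real.exp (θ * S) ≤ Real.exp ((θ - δ) * S) :=
          Real.exp_le_exp.2 (by nlinarith)
        rw [Set.indicator_of_notMem (by exact hS)]
        have := mul_pos (Real.exp_pos (-(κ * δ * N))) (Real.exp_pos ((θ + δ) * S))
        linarith
  have hsum : Integrable (fun x : Fin N → ℝ => {x : Fin N → ℝ | 0 ≤ ∑ i, x i}.indicator
      (fun _ => Real.exp (θ * κ * N)) x + Real.exp ((θ - δ) * ∑ i, x i)) π :=
    ((integrable_const _).indicator hmeas).add (hint _ h1)
  rw [integral_add hsum
    ((hint _ h2).const_mul _), integral_add ((integrable_const _).indicator hmeas) (hint _ h1),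
    integral_const_mul, hval, hval, hval, integral_indicator_const _ hmeas] at key
  simp only [smul_eq_mul] at key
  linarith [mul_comm (Real.exp (θ * κ * N)) (π.real {x | 0 ≤ ∑ i, x i})]

theorem exists_pos_measure_Ici_ne_zero {μ : Measure ℝ} (hpos : μ (Set.Ioi 0) ≠ 0) :
    ∃ r : ℝ, 0 < r ∧ μ (Set.Ici r) ≠ 0 := by
  by_contra! h
  apply hpos
  have : Set.Ioi (0 : ℝ) = ⋃ n : ℕ, Set.Ici (1 / ((n : ℝ) + 1)) := by
    ext y
    simp only [Set.mem_Ioi, Set.mem_iUnion, Set.mem_Ici]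
    constructor
    · intro hy
      obtain ⟨n, hn⟩ := exists_nat_one_div_lt hy
      exact ⟨n, hn.le⟩
    · rintro ⟨n, hn⟩
      exact lt_of_lt_of_le (by positivity) hn
  rw [this, measure_iUnion_null_iff]
  exact fun n => h _ (by positivity)

/-- Cramér's lower bound at the level `0` for a finite measure all of whose exponential moments
are finite. -/
theorem eventually_le_pi_sum_nonneg (μ : Measure ℝ) [IsFiniteMeasure μ]
    (hμ : ∀ t, t ∈ integrableExpSet id μ) (hpos : μ (Set.Ioi 0) ≠ 0)
    {m : ℝ} (hm : 0 < m) (hM : ∀ θ, 0 ≤ θ → m ≤ mgf id μ θ) {ε : ℝ} (hε : 0 < ε) :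
    ∀ᶠ N : ℕ in atTop, (m * Real.exp (-ε)) ^ N ≤
      (Measure.pi fun _ : Fin N => μ).real {x | 0 ≤ ∑ i, x i} := by
  set M := mgf id μ
  have huniv : integrableExpSet id μ = Set.univ := Set.eq_univ_of_forall hμ
  have hder : ∀ t, HasDerivAt M (deriv M t) t := fun t =>
    (hasDerivAt_mgf (X := id) (μ := μ) (t := t) (by simp [huniv])).differentiableAt.hasDerivAt
  have hcont : Continuous M := continuous_iff_continuousAt.2 fun t => (hder t).continuousAt
  -- Mass on some [r, ∞) with r > 0 makes `M` tend to infinity, so its minimum over [0, ∞) is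
  -- attained in [0, B].
  obtain ⟨B, hB⟩ : ∃ B : ℝ, ∀ θ, B ≤ θ → M 0 < M θ := by
    obtain ⟨r, hr, hr'⟩ := exists_pos_measure_Ici_ne_zero hpos
    have hq : 0 < μ.real (Set.Ici r) :=
      ENNReal.toReal_pos hr' (measure_ne_top _ _)
    have hlim : Tendsto (fun θ : ℝ => Real.exp (θ * r) * μ.real (Set.Ici r)) atTop atTop :=
      (Real.tendsto_exp_atTop.comp (tendsto_id.atTop_mul_const hr)).atTop_mul_const hq
    obtain ⟨B, hB⟩ := eventually_atTop.1
      ((hlim.eventually_gt_atTop (M 0)).and (eventually_ge_atTop 0))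
    refine ⟨B, fun θ hθ => (hB θ hθ).1.trans_le ?_⟩
    have := measure_ge_le_exp_mul_mgf (X := id) (μ := μ) r (hB θ hθ).2 (hμ θ)
    have h2 : μ.real (Set.Ici r) ≤ Real.exp (-θ * r) * M θ := this
    calc Real.exp (θ * r) * μ.real (Set.Ici r)
        ≤ Real.exp (θ * r) * (Real.exp (-θ * r) * M θ) := by gcongr
      _ = M θ := by rw [← mul_assoc, ← Real.exp_add]; simp
  have hB0 : 0 < B := by
    by_contra! h
    exact lt_irrefl _ (hB 0 h)
  obtain ⟨θm, hθm, hmin⟩ := isCompact_Icc.exists_isMinOn (Set.nonempty_Icc.2 hB0.le)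
    hcont.continuousOn
  have hcomp : IsCompact (Set.Icc 0 B ∩ {θ | M θ ≤ M θm}) :=
    isCompact_Icc.inter_right (isClosed_le hcont continuous_const)
  -- The largest minimiser, so that `M` is strictly larger everywhere to its right; no strict
  -- convexity is needed.
  obtain ⟨θ₀, ⟨⟨hθ₀, hθ₀B⟩, hle⟩, hgr⟩ := hcomp.exists_isGreatest ⟨θm, hθm, le_refl (M θm)⟩
  have hmin' : ∀ θ, 0 ≤ θ → M θ₀ ≤ M θ := by
    intro θ hθ
    refine le_trans hle ?_
    by_cases h : θ ≤ B
    · exact hmin ⟨hθ, h⟩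
    · exact le_trans (hmin ⟨le_refl _, hB0.le⟩) (hB θ (not_le.1 h).le).le
  have hstrict : ∀ θ, θ₀ < θ → M θ₀ < M θ := by
    intro θ hθ
    refine lt_of_le_of_lt hle ?_
    by_cases h : θ ≤ B
    · by_contra! h'
      exact absurd (hgr ⟨⟨hθ₀.trans hθ.le, h⟩, h'⟩) (not_le.2 hθ)
    · exact lt_of_le_of_lt (hmin ⟨le_refl _, hB0.le⟩) (hB θ (not_le.1 h).le)
  have hM0 : 0 < M θ₀ := hm.trans_le (hM _ hθ₀)
  -- If θ₀ = 0, the cost θ₀κ vanishes and κ can be large enough to beat the derivative; if θ₀ > 0,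
  -- the derivative vanishes and κ can be small. The factor 2 is the slope of δ ↦ θ₀ + 2δ.
  obtain ⟨κ, hκ, hκε, hκD⟩ : ∃ κ : ℝ, 0 < κ ∧ θ₀ * κ < ε ∧ 2 * deriv M θ₀ < κ * M θ₀ := by
    rcases hθ₀.eq_or_lt with h | h
    · refine ⟨2 * |deriv M θ₀| / M θ₀ + 1, by positivity, by rw [← h]; simpa using hε, ?_⟩
      rw [add_mul, div_mul_cancel₀ _ hM0.ne']
      linarith [le_abs_self (deriv M θ₀)]
    · have hD : deriv M θ₀ = 0 := by
        apply IsLocalMin.deriv_eq_zero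
        filter_upwards [lt_mem_nhds h] with θ hθ using hmin' θ hθ.le
      refine ⟨ε / (2 * θ₀), by positivity, ?_, by rw [hD, mul_zero]; positivity⟩
      have : θ₀ * (ε / (2 * θ₀)) = ε / 2 := by field_simp
      linarith
  obtain ⟨δ, hδ, hδε, hδM⟩ : ∃ δ : ℝ, 0 < δ ∧ (θ₀ + δ) * κ < ε ∧
      M (θ₀ + 2 * δ) < M θ₀ * (1 + κ * δ) := by
    have e1 : ∀ᶠ δ : ℝ in 𝓝[>] 0, (θ₀ + δ) * κ < ε := by
      apply nhdsWithin_le_nhds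
      have : ContinuousAt (fun δ : ℝ => (θ₀ + δ) * κ) 0 := by fun_prop
      exact this.eventually_lt_const (by simpa using hκε)
    have e2 : ∀ᶠ δ : ℝ in 𝓝[>] 0, M (θ₀ + 2 * δ) < M θ₀ * (1 + κ * δ) := by
      have hd : HasDerivAt (fun δ : ℝ => M (θ₀ + 2 * δ)) (2 * deriv M θ₀) 0 := by
        have h1 : HasDerivAt (fun δ : ℝ => θ₀ + 2 * δ) 2 0 := by
          simpa using ((hasDerivAt_id (0 : ℝ)).const_mul 2).const_add θ₀
        have h2 : HasDerivAt M (deriv M θ₀) (θ₀ + 2 * 0) := by simpa using hder θ₀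
        rw [mul_comm]
        exact h2.comp (0 : ℝ) h1
      have hs := (hasDerivAt_iff_tendsto_slope.1 hd).mono_left
        (nhdsWithin_mono (0 : ℝ) (fun y (hy : 0 < y) => hy.ne'))
      filter_upwards [hs.eventually_lt_const hκD, self_mem_nhdsWithin] with δ hδ hδ0
      rw [slope_def_field, div_lt_iff₀ (by simpa using hδ0)] at hδ
      simp only [mul_zero, add_zero, sub_zero] at hδ
      linarith
    obtain ⟨δ, h⟩ := ((e1.and e2).and self_mem_nhdsWithin).exists
    exact ⟨δ, h.2, h.1.1, h.1.2⟩
  set θ := θ₀ + δ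
  have hMθ : M θ₀ < M θ := hstrict _ (by simp [θ, hδ])
  have hMθ0 : 0 < M θ := hM0.trans hMθ
  have hexp : M (θ + δ) < Real.exp (κ * δ) * M θ := by
    have : θ + δ = θ₀ + 2 * δ := by simp only [θ]; ring
    rw [this]
    refine hδM.trans ?_
    rw [mul_comm]
    have h1 : 1 + κ * δ ≤ Real.exp (κ * δ) := by linarith [Real.add_one_le_exp (κ * δ)]
    exact mul_lt_mul' h1 hMθ hM0.le (Real.exp_pos _)
  -- With θ = θ₀ + δ, both error terms M(θ - δ)^N = M(θ₀)^N and exp (-κδN) M(θ + δ)^N are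
  -- exponentially smaller than M(θ)^N, so half of the latter survives. The factor exp (θκN) is paid
  -- for by ε.
  have t1 := tendsto_pow_atTop_nhds_zero_of_lt_one (r := M θ₀ / M θ) (by positivity)
    ((div_lt_one hMθ0).2 hMθ)
  have t2 := tendsto_pow_atTop_nhds_zero_of_lt_one (r := M (θ + δ) / (Real.exp (κ * δ) * M θ))
    (div_nonneg mgf_nonneg (by positivity)) ((div_lt_one (by positivity)).2 hexp)
  have t3 := tendsto_pow_atTop_nhds_zero_of_lt_one (r := Real.exp (θ * κ - ε)) (by positivity)
    (by rw [Real.exp_lt_one_iff]; linarith)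
  filter_upwards [t1.eventually_lt_const (show (0 : ℝ) < 1 / 4 by norm_num),
    t2.eventually_lt_const (show (0 : ℝ) < 1 / 4 by norm_num),
    t3.eventually_lt_const (show (0 : ℝ) < 1 / 2 by norm_num)] with N h1 h2 h3
  have hmain := pow_mgf_sub_le_pi_sum_nonneg μ (θ := θ) (δ := δ) (κ := κ)
    (by positivity) hδ.le (hμ _) (hμ _) (hμ _) N
  have hθδ : θ - δ = θ₀ := by simp [θ]
  rw [hθδ] at hmain
  set p := (Measure.pi fun _ : Fin N => μ).real {x | 0 ≤ ∑ i, x i}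
  rw [div_pow, div_lt_iff₀ (by positivity)] at h1
  rw [div_pow, div_lt_iff₀ (by positivity), mul_pow, ← Real.exp_nat_mul] at h2
  have h2' : Real.exp (-(κ * δ * N)) * M (θ + δ) ^ N < 1 / 4 * M θ ^ N := by
    calc Real.exp (-(κ * δ * N)) * M (θ + δ) ^ N
        < Real.exp (-(κ * δ * N)) * (1 / 4 * (Real.exp (N * (κ * δ)) * M θ ^ N)) := by gcongr
      _ = (Real.exp (-(κ * δ * N)) * Real.exp (N * (κ * δ))) * (1 / 4 * M θ ^ N) := by ring
      _ = 1 / 4 * M θ ^ N := by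
        rw [← Real.exp_add, show -(κ * δ * N) + N * (κ * δ) = 0 by ring]; simp
  have h4 : 1 / 2 * M θ ^ N ≤ Real.exp (θ * κ * N) * p := by
    change M θ ^ N - M θ₀ ^ N - Real.exp (-(κ * δ * N)) * M (θ + δ) ^ N ≤ _ at hmain
    linarith
  have h5 : Real.exp (θ * κ * N) * (m * Real.exp (-ε)) ^ N ≤ 1 / 2 * M θ ^ N := by
    calc Real.exp (θ * κ * N) * (m * Real.exp (-ε)) ^ N
        = Real.exp (θ * κ - ε) ^ N * m ^ N := by
          rw [mul_pow, ← Real.exp_nat_mul, ← Real.exp_nat_mul, mul_comm (m ^ N), ← mul_assoc,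
            ← Real.exp_add]
          ring_nf
      _ ≤ 1 / 2 * M θ ^ N := by
          have := hM θ (by positivity)
          gcongr
  exact le_of_mul_le_mul_left (h5.trans h4) (Real.exp_pos _)

theorem mem_integrableExpSet_restrict_Iic (ν : Measure ℝ) [IsFiniteMeasure ν] {a : ℝ}
    (ha : ∀ᵐ v ∂ν, a ≤ v) (K t : ℝ) : t ∈ integrableExpSet id (ν.restrict (Set.Iic K)) := by
  refine Integrable.of_bound (C := Real.exp (|t| * max |a| |K|)) (by fun_prop) ?_
  filter_upwards [ae_restrict_of_ae ha, ae_restrict_mem measurableSet_Iic] with v hv hv'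
  rw [Real.norm_eq_abs, Real.abs_exp, Real.exp_le_exp]
  refine (le_abs_self _).trans ?_
  rw [abs_mul]
  gcongr
  exact abs_le_max_abs_abs hv hv'

theorem Iic_subset_integrableExpSet (ν : Measure ℝ) [IsFiniteMeasure ν] {a : ℝ}
    (ha : ∀ᵐ v ∂ν, a ≤ v) {θ : ℝ} (h : θ ∈ integrableExpSet id ν) :
    Set.Iic θ ⊆ integrableExpSet id ν := by
  intro t ht
  rcases le_total 0 t with h0 | h0
  · exact integrable_exp_mul_of_nonneg_of_le h h0 ht
  · refine Integrable.of_bound (C := Real.exp (t * a)) (by fun_prop) ?_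
    filter_upwards [ha] with v hv
    rw [Real.norm_eq_abs, Real.abs_exp, Real.exp_le_exp]
    exact mul_le_mul_of_nonpos_left hv h0

/-- Truncation does not lower the infimum of the moment generating function much. -/
theorem exists_restrict_Iic_mgf_ge (ν : Measure ℝ) [IsProbabilityMeasure ν] {a : ℝ}
    (ha : ∀ᵐ v ∂ν, a ≤ v) (hpos : ν (Set.Ioi 0) ≠ 0)
    (hmgf : ∃ θ : ℝ, 0 < θ ∧ θ ∈ integrableExpSet id ν) {m : ℝ}
    (hm : ∀ θ, 0 < θ → θ ∈ integrableExpSet id ν → m ≤ mgf id ν θ) {m' : ℝ} (hm' : m' < m) :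
    ∃ K : ℝ, ν.restrict (Set.Iic K) (Set.Ioi 0) ≠ 0 ∧
      ∀ θ, 0 ≤ θ → m' ≤ mgf id (ν.restrict (Set.Iic K)) θ := by
  have hi := mem_integrableExpSet_restrict_Iic ν ha
  set M : ℕ → ℝ → ℝ := fun k => mgf id (ν.restrict (Set.Iic (k : ℝ))) with hMdef
  have huniv : ∀ k : ℕ, integrableExpSet id (ν.restrict (Set.Iic (k : ℝ))) = Set.univ :=
    fun k => Set.eq_univ_of_forall (hi k)
  have hcont : ∀ k, Continuous (M k) := fun k => continuous_iff_continuousAt.2 fun t =>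
    (hasDerivAt_mgf (by simp [huniv])).continuousAt
  have hmono : Monotone M := by
    intro k l hkl t
    refine integral_mono_measure (Measure.restrict_mono (Set.Iic_subset_Iic.2 (by simpa)) le_rfl)
      (ae_of_all _ fun x => (Real.exp_pos _).le) (hi l t)
  obtain ⟨r, hr, hr'⟩ := exists_pos_measure_Ici_ne_zero hpos
  obtain ⟨k₀, hk₀⟩ : ∃ k₀ : ℕ, ν.restrict (Set.Iic (k₀ : ℝ)) (Set.Ici r) ≠ 0 := by
    by_contra! h
    apply hr'
    have : Set.Ici r = ⋃ n : ℕ, Set.Ici r ∩ Set.Iic (n : ℝ) := by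
      rw [← Set.inter_iUnion, Set.inter_eq_left.2]
      intro x _
      obtain ⟨n, hn⟩ := exists_nat_ge x
      exact Set.mem_iUnion.2 ⟨n, hn⟩
    rw [this, measure_iUnion_null_iff]
    intro n
    rw [← Measure.restrict_apply measurableSet_Ici]
    exact h n
  have hq : 0 < (ν.restrict (Set.Iic (k₀ : ℝ))).real (Set.Ici r) :=
    ENNReal.toReal_pos hk₀ (measure_ne_top _ _)
  obtain ⟨C, hC⟩ : ∃ C : ℝ, ∀ θ, C ≤ θ → m' < M k₀ θ := by
    have hlim : Tendsto (fun θ : ℝ => Real.exp (θ * r) *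
        (ν.restrict (Set.Iic (k₀ : ℝ))).real (Set.Ici r)) atTop atTop :=
      (Real.tendsto_exp_atTop.comp (tendsto_id.atTop_mul_const hr)).atTop_mul_const hq
    obtain ⟨B, hB⟩ := eventually_atTop.1
      ((hlim.eventually_gt_atTop m').and (eventually_ge_atTop 0))
    refine ⟨B, fun θ hθ => (hB θ hθ).1.trans_le ?_⟩
    have h2 : (ν.restrict (Set.Iic (k₀ : ℝ))).real (Set.Ici r) ≤
        Real.exp (-θ * r) * M k₀ θ :=
      measure_ge_le_exp_mul_mgf (X := id) r (hB θ hθ).2 (hi k₀ θ)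
    calc Real.exp (θ * r) * (ν.restrict (Set.Iic (k₀ : ℝ))).real (Set.Ici r)
        ≤ Real.exp (θ * r) * (Real.exp (-θ * r) * M k₀ θ) := by gcongr
      _ = M k₀ θ := by rw [← mul_assoc, ← Real.exp_add]; simp
  -- Otherwise the sets {θ ≥ 0 | M_k(θ) ≤ m'} are nonempty, compact and decreasing in k. At a common
  -- point θ₁ the limit k → ∞ gives finiteness of the moment generating function of ν and a value at
  -- most m' < m.
  by_contra! hcon
  have hpos' : ∀ k : ℕ, ν.restrict (Set.Iic ((k₀ + k : ℕ) : ℝ)) (Set.Ioi 0) ≠ 0 := by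
    intro k h
    apply hk₀
    refine le_antisymm (le_trans ?_ h.le) zero_le
    refine le_trans (Measure.restrict_mono (Set.Iic_subset_Iic.2 ?_) le_rfl _)
      (measure_mono (Set.Ici_subset_Ioi.2 hr))
    simp
  obtain ⟨θ₁, hθ₁⟩ := IsCompact.nonempty_iInter_of_sequence_nonempty_isCompact_isClosed
    (fun k : ℕ => Set.Ici 0 ∩ {θ | M (k₀ + k) θ ≤ m'})
    (fun k θ hθ => ⟨hθ.1, (hmono (by lia : k₀ + k ≤ k₀ + (k + 1)) θ).trans hθ.2⟩)
    (fun k => by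
      obtain ⟨θ, h0, h⟩ := hcon _ (hpos' k)
      exact ⟨θ, h0, h.le⟩)
    (isCompact_Icc.of_isClosed_subset (isClosed_Ici.inter (isClosed_le (hcont _) continuous_const))
      (fun θ hθ => ⟨hθ.1, by
        by_contra! h
        exact (hC θ h.le).not_ge hθ.2⟩ : _ ⊆ Set.Icc (0 : ℝ) C))
    (fun k => isClosed_Ici.inter (isClosed_le (hcont _) continuous_const))
  simp only [Set.mem_iInter, Set.mem_inter_iff, Set.mem_Ici, Set.mem_ofPred_eq] at hθ₁
  have h0 : 0 ≤ θ₁ := (hθ₁ 0).1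
  have hcov : AECover ν atTop fun k : ℕ => Set.Iic ((k₀ + k : ℕ) : ℝ) :=
    aecover_Iic (tendsto_natCast_atTop_atTop.comp
      (tendsto_atTop_mono (fun k => Nat.le_add_left k k₀) tendsto_id))
  have hint : θ₁ ∈ integrableExpSet id ν :=
    hcov.integrable_of_integral_bounded_of_nonneg_ae m' (fun k => hi _ θ₁)
      (ae_of_all _ fun x => (Real.exp_pos _).le) (Eventually.of_forall fun k => (hθ₁ k).2)
  have hle : mgf id ν θ₁ ≤ m' :=
    le_of_tendsto (hcov.integral_tendsto_of_countably_generated hint)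
      (Eventually.of_forall fun k => (hθ₁ k).2)
  -- The hypothesis on `m` covers only θ > 0, so θ₁ = 0 is reached by continuity from the right.
  rcases h0.eq_or_lt with h | h
  · obtain ⟨θ, hθ, hθi⟩ := hmgf
    have hsub := Iic_subset_integrableExpSet ν ha hθi
    have hint0 : (0 : ℝ) ∈ interior (integrableExpSet id ν) :=
      mem_interior.2 ⟨Set.Iio θ, Set.Iio_subset_Iic_self.trans hsub, isOpen_Iio, hθ⟩
    have hc : Tendsto (mgf id ν) (𝓝[>] 0) (𝓝 (mgf id ν 0)) :=
      (hasDerivAt_mgf hint0).continuousAt.tendsto.mono_left nhdsWithin_le_nhds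
    have : m ≤ mgf id ν 0 := by
      refine ge_of_tendsto hc ?_
      filter_upwards [Ioo_mem_nhdsGT hθ] with t ht
      exact hm t ht.1 (hsub ht.2.le)
    rw [← h] at hle
    linarith
  · linarith [hm θ₁ h hint]

/-- **Cramér's lower bound** at the level `0`. -/
theorem eventually_exp_le_pi_sum_nonneg (ν : Measure ℝ) [IsProbabilityMeasure ν] {a : ℝ}
    (ha : ∀ᵐ v ∂ν, a ≤ v)
    (hmgf : ∃ θ : ℝ, 0 < θ ∧ θ ∈ integrableExpSet id ν) {B : ℝ}
    (hB : ∀ θ, 0 < θ → θ ∈ integrableExpSet id ν → Real.exp (-B) ≤ mgf id ν θ)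
    {ε : ℝ} (hε : 0 < ε) :
    ∀ᶠ N : ℕ in atTop, Real.exp (-((B + ε) * N)) ≤
      (Measure.pi fun _ : Fin N => ν).real {x | 0 ≤ ∑ i, x i} := by
  -- Without mass on (0, ∞) the infimum of the moment generating function is only approached as θ →
  -- ∞, with limit the atom at 0; the event that all variables vanish then suffices.
  by_cases hpos : ν (Set.Ioi 0) = 0
  · have hle : ∀ᵐ v ∂ν, v ≤ 0 := by
      rw [ae_iff]
      exact measure_mono_null (fun v hv => not_le.1 hv) hpos
    have hlim : Tendsto (mgf id ν) atTop (𝓝 (ν.real {0})) := by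
      have h := tendsto_integral_filter_of_dominated_convergence (μ := ν) (l := atTop)
        (F := fun (θ : ℝ) (v : ℝ) => Real.exp (θ * v)) (f := Set.indicator {0} 1)
        (fun _ => 1) (Eventually.of_forall fun θ => by fun_prop)
        (by
          filter_upwards [eventually_ge_atTop 0] with θ hθ
          filter_upwards [hle] with v hv
          rw [Real.norm_eq_abs, Real.abs_exp, Real.exp_le_one_iff]
          exact mul_nonpos_of_nonneg_of_nonpos hθ hv)
        (integrable_const _)
        (by
          filter_upwards [hle] with v hv
          rcases hv.eq_or_lt with h | h
          · simp [h]
          · rw [Set.indicator_of_notMem (by simpa using h.ne)]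
            exact Real.tendsto_exp_atBot.comp (tendsto_id.atTop_mul_const_of_neg h))
      rwa [integral_indicator_one (measurableSet_singleton _)] at h
    have h0 : Real.exp (-B) ≤ ν.real {0} := by
      refine ge_of_tendsto hlim ?_
      filter_upwards [eventually_gt_atTop 0] with θ hθ
      refine hB θ hθ (Integrable.of_bound (C := 1) (by fun_prop) ?_)
      filter_upwards [hle] with v hv
      rw [Real.norm_eq_abs, Real.abs_exp, Real.exp_le_one_iff]
      exact mul_nonpos_of_nonneg_of_nonpos hθ.le hv
    refine Eventually.of_forall fun N => ?_
    have hsub : ({0} : Set (Fin N → ℝ)) ⊆ {x | 0 ≤ ∑ i, x i} := by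
      rintro x rfl; simp
    refine le_trans ?_ (measureReal_mono hsub)
    have : (Measure.pi fun _ : Fin N => ν).real {0} = ν.real {0} ^ N := by
      simp [measureReal_def]
    rw [this]
    calc Real.exp (-((B + ε) * N)) ≤ Real.exp (-B) ^ N := by
          rw [← Real.exp_nat_mul, Real.exp_le_exp]
          nlinarith [mul_nonneg hε.le (Nat.cast_nonneg (α := ℝ) N)]
      _ ≤ _ := by gcongr
  · have hlt : Real.exp (-(B + ε / 2)) < Real.exp (-B) := Real.exp_lt_exp.2 (by linarith)
    obtain ⟨K, hK, hK'⟩ := exists_restrict_Iic_mgf_ge ν ha hpos hmgf hB hlt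
    filter_upwards [eventually_le_pi_sum_nonneg (ν.restrict (Set.Iic K))
      (mem_integrableExpSet_restrict_Iic ν ha K) hK (Real.exp_pos _) hK' (half_pos hε)] with N hN
    rw [← Real.exp_add, ← Real.exp_nat_mul] at hN
    calc Real.exp (-((B + ε) * N)) = Real.exp (N * (-(B + ε / 2) + -(ε / 2))) := by ring_nf
      _ ≤ _ := hN
      _ ≤ _ := by
        rw [← Measure.restrict_pi_pi]
        exact ENNReal.toReal_mono (measure_ne_top _ _) (Measure.restrict_apply_le _ _)

/-- **Cramér's lower bound** for the sums of independent variables with law `ν`. -/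
theorem cramer_lower_bound (ν : Measure ℝ) [IsProbabilityMeasure ν]
    (hν : ∀ᵐ v ∂ν, 0 ≤ v)
    (hmgf : ∃ θ : ℝ, 0 < θ ∧ θ ∈ integrableExpSet id ν) {a B : ℝ}
    (hB : ∀ θ, 0 < θ → θ ∈ integrableExpSet id ν → θ * a - cgf id ν θ ≤ B)
    {ε : ℝ} (hε : 0 < ε) :
    ∀ᶠ N : ℕ in atTop, Real.exp (-((B + ε) * N)) ≤
      (Measure.pi fun _ : Fin N => ν).real {x | N * a ≤ ∑ i, x i} := by
  -- Centring at `a` reduces to level 0; the shifted law is still bounded below, by -a.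
  set μ := ν.map (fun v => v - a)
  have hf : Measurable fun v : ℝ => v - a := by fun_prop
  have : IsProbabilityMeasure μ := Measure.isProbabilityMeasure_map hf.aemeasurable
  have hset : ∀ θ, θ ∈ integrableExpSet id μ ↔ θ ∈ integrableExpSet id ν := by
    intro θ
    simp only [integrableExpSet, Set.mem_ofPred_eq, id]
    rw [integrable_map_measure (by fun_prop) hf.aemeasurable]
    have : ((fun ω => Real.exp (θ * ω)) ∘ fun v : ℝ => v - a) =
        fun v => Real.exp (-(θ * a)) * Real.exp (θ * v) := by
      ext v; simp only [Function.comp]; rw [← Real.exp_add]; ring_nf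
    rw [this, integrable_const_mul_iff (by simp)]
  have hmgf' : ∀ θ, mgf id μ θ = Real.exp (-(θ * a)) * mgf id ν θ := by
    intro θ
    simp only [mgf, id]
    rw [integral_map hf.aemeasurable (by fun_prop), ← integral_const_mul]
    congr with v
    rw [← Real.exp_add]; ring_nf
  have h := eventually_exp_le_pi_sum_nonneg μ (a := -a) (B := B)
    ((ae_map_iff hf.aemeasurable measurableSet_Ici).2 (by
      filter_upwards [hν] with v hv
      change -a ≤ v - a
      linarith))
    (by simpa only [hset] using hmgf)
    (by
      intro θ hθ hi
      rw [hset] at hi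
      have h1 := hB θ hθ hi
      have hp : 0 < mgf id ν θ := mgf_pos hi
      rw [hmgf', ← Real.exp_log hp, ← Real.exp_add, Real.exp_le_exp]
      change θ * a - Real.log (mgf id ν θ) ≤ B at h1
      linarith) hε
  filter_upwards [h] with N hN
  refine hN.trans_eq ?_
  have hpi : (Measure.pi fun _ : Fin N => μ) =
      (Measure.pi fun _ : Fin N => ν).map (fun x i => x i - a) :=
    (Measure.pi_map_pi (μ := fun _ : Fin N => ν) (f := fun _ v => v - a)
      (fun _ => hf.aemeasurable)).symm
  rw [hpi, map_measureReal_apply (by fun_prop) (measurableSet_le measurable_const (by fun_prop))]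
  congr 1
  ext x
  simp [Finset.sum_sub_distrib]

/-! ### The order of transmission -/

section Schedule

variable {η : ℕ} (d : Fin η → ℕ) (N : Fin η → ℕ)

/-- The packets transmitted from the start of round `r` through `p`, in order of transmission. -/
def servedFrom (p : Packet η) (r : ℕ) : List (Packet η) :=
  ((List.range' r (roundOf d p - r)).flatMap (roundPackets d N)) ++ roundUpTo d N p

theorem servedUpTo_eq_append (p : Packet η) {r : ℕ} (hr : r ≤ roundOf d p) :
    servedUpTo d N p =
      (List.range r).flatMap (roundPackets d N) ++ servedFrom d N p r := by
  obtain ⟨s, hs⟩ := Nat.exists_eq_add_of_le hr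
  simp only [servedUpTo, servedFrom, hs, List.range_eq_range', Nat.add_sub_cancel_left]
  rw [← List.range'_append_1, List.flatMap_append, List.append_assoc, zero_add]

theorem servedFrom_of_lt (p : Packet η) {r : ℕ} (hr : r < roundOf d p) :
    servedFrom d N p r = roundPackets d N r ++ servedFrom d N p (r + 1) := by
  obtain ⟨s, hs⟩ := Nat.exists_eq_add_of_le' (Nat.sub_pos_of_lt hr)
  have h2 : roundOf d p - (r + 1) = s := by lia
  simp only [servedFrom, hs, h2, List.range'_succ, List.flatMap_cons, List.append_assoc,
    Nat.succ_eq_add_one, zero_add]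

theorem mem_roundPackets {r : ℕ} {q : Packet η} :
    q ∈ roundPackets d N r ↔
      r % d q.1 = 0 ∧ 1 ≤ q.2.1 ∧ q.2.1 ≤ N q.1 ∧ q.2.2 = r / d q.1 + 1 := by
  obtain ⟨g, i, k⟩ := q
  simp only [roundPackets, List.mem_flatMap, List.mem_filter, List.mem_finRange, true_and,
    decide_eq_true_eq, List.mem_map, List.mem_range, Prod.mk.injEq]
  constructor
  · rintro ⟨g', h, i', hi', rfl, rfl, rfl⟩
    exact ⟨h, by lia, by lia, rfl⟩
  · rintro ⟨h, h1, h2, rfl⟩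
    exact ⟨g, h, i - 1, by lia, rfl, by lia, rfl⟩

theorem roundOf_of_mem_roundPackets {r : ℕ} {q : Packet η} (hq : q ∈ roundPackets d N r) :
    roundOf d q = r := by
  obtain ⟨h, -, -, h'⟩ := (mem_roundPackets d N).1 hq
  rw [roundOf, h', Nat.add_sub_cancel]
  exact Nat.mul_div_cancel' (Nat.dvd_of_mod_eq_zero h)

theorem roundOf_of_mem_roundUpTo {p q : Packet η} (hq : q ∈ roundUpTo d N p) :
    roundOf d q = roundOf d p := by
  rcases List.mem_append.1 hq with h | h
  · exact roundOf_of_mem_roundPackets d N ((List.takeWhile_sublist _).subset h)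
  · rw [List.mem_singleton.1 h]

theorem one_le_of_mem_roundUpTo {p q : Packet η} (hp : 1 ≤ p.2.2) (hq : q ∈ roundUpTo d N p) :
    1 ≤ q.2.2 := by
  rcases List.mem_append.1 hq with h | h
  · have := ((mem_roundPackets d N).1 ((List.takeWhile_sublist _).subset h)).2.2.2
    lia
  · rwa [List.mem_singleton.1 h]

theorem nodup_roundPackets (r : ℕ) : (roundPackets d N r).Nodup := by
  refine List.nodup_flatMap.2 ⟨fun g _ => ?_, ?_⟩
  · refine List.nodup_range.map fun i j h => ?_
    simpa using h
  · refine ((List.nodup_finRange η).filter _).imp fun {a c} hac => ?_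
    intro q hq hq'
    simp only [List.mem_map] at hq hq'
    obtain ⟨_, _, rfl⟩ := hq
    obtain ⟨_, _, h⟩ := hq'
    simp only [Prod.mk.injEq] at h
    exact hac h.1.symm

theorem nodup_roundUpTo (p : Packet η) : (roundUpTo d N p).Nodup := by
  refine List.Nodup.append ((nodup_roundPackets d N _).sublist (List.takeWhile_sublist _))
    (List.nodup_singleton p) ?_
  intro q hq hq'
  have := List.mem_takeWhile_imp hq
  simp only [List.mem_singleton] at hq'
  simp [hq'] at this

theorem nodup_servedFrom (p : Packet η) (r : ℕ) : (servedFrom d N p r).Nodup := by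
  refine List.Nodup.append (List.nodup_flatMap.2 ⟨fun r _ => nodup_roundPackets d N r, ?_⟩)
    (nodup_roundUpTo d N p) ?_
  · refine (List.nodup_range' (h := by norm_num)).imp fun {a c} hac => ?_
    intro q hq hq'
    exact hac ((roundOf_of_mem_roundPackets d N hq).symm.trans
      (roundOf_of_mem_roundPackets d N hq'))
  · intro q hq hq'
    obtain ⟨s, hs, hqs⟩ := List.mem_flatMap.1 hq
    have h1 := roundOf_of_mem_roundPackets d N hqs
    have h2 := roundOf_of_mem_roundUpTo d N hq'
    have h3 := List.mem_range'_1.1 hs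
    lia

/-! ### Departure times as a maximum over rounds -/

section Queue

variable (b : ℝ) (n : ℕ) (v : Packet η → ℝ)

/-- The reason why waiting matters only at the start of a round: the arrival time depends on the
packet only through its round. -/
theorem arrivalTime_eq {q : Packet η} (hq : 1 ≤ q.2.2) :
    arrivalTime d b n q.1 q.2.2 = roundOf d q * (n * b) := by
  rw [arrivalTime, roundOf]
  push_cast [Nat.cast_sub hq]
  ring

theorem add_sum_le_foldl (L : List (Packet η)) (t : ℝ) :
    t + (L.map v).sum ≤
      L.foldl (fun t q => max t (arrivalTime d b n q.1 q.2.2) + v q) t := by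
  induction L generalizing t with
  | nil => simp
  | cons q L ih =>
    simp only [List.map_cons, List.sum_cons, List.foldl_cons]
    refine le_trans ?_ (ih _)
    linarith [le_max_left t (arrivalTime d b n q.1 q.2.2)]

theorem arrival_add_sum_le_foldl {L : List (Packet η)} (hL : L ≠ []) {a : ℝ}
    (ha : ∀ q ∈ L.head?, a ≤ arrivalTime d b n q.1 q.2.2) (t : ℝ) :
    a + (L.map v).sum ≤
      L.foldl (fun t q => max t (arrivalTime d b n q.1 q.2.2) + v q) t := by
  cases L with
  | nil => exact absurd rfl hL
  | cons q L =>
    simp only [List.map_cons, List.sum_cons, List.foldl_cons]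
    refine le_trans ?_ (add_sum_le_foldl d b n v _ _)
    have := ha q (by simp)
    linarith [le_max_right t (arrivalTime d b n q.1 q.2.2)]

/-- If all arrivals are postponed to the common time `a`, the station waits at most once, before the
first packet, since nonnegative transmission times keep the clock above `a` afterwards. -/
theorem foldl_le_max_add_sum {L : List (Packet η)} {a : ℝ}
    (ha : ∀ q ∈ L, arrivalTime d b n q.1 q.2.2 ≤ a) (hv : ∀ q, 0 ≤ v q) (t : ℝ) :
    L.foldl (fun t q => max t (arrivalTime d b n q.1 q.2.2) + v q) t ≤
      max t a + (L.map v).sum := by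
  induction L generalizing t with
  | nil => simp
  | cons q L ih =>
    simp only [List.map_cons, List.sum_cons, List.foldl_cons]
    refine (ih (fun q hq => ha q (List.mem_cons_of_mem _ hq)) _).trans ?_
    have h1 := max_le_max_left t (ha q List.mem_cons_self)
    have h2 : a ≤ max t a + v q := (le_max_right t a).trans (by linarith [hv q])
    have := max_le (add_le_add_left h1 (v q)) h2
    linarith

theorem completionTime_append (L L' : List (Packet η)) :
    completionTime d b n v (L ++ L') =
      L'.foldl (fun t q => max t (arrivalTime d b n q.1 q.2.2) + v q)
        (completionTime d b n v L) := by
  simp [completionTime]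

theorem arrivalTime_of_mem_roundPackets {r : ℕ} {q : Packet η} (hq : q ∈ roundPackets d N r) :
    arrivalTime d b n q.1 q.2.2 = r * (n * b) := by
  rw [arrivalTime_eq, roundOf_of_mem_roundPackets d N hq]
  have := ((mem_roundPackets d N).1 hq).2.2.2
  lia

/-- Induction on the rounds. Either the clock has passed the arrival time of the new round, and the
earlier `s` is kept, or the station catches up with the arrivals and `s` is reset to the new round.
-/
theorem completionTime_rounds_le (hv : ∀ q, 0 ≤ v q) (r : ℕ) :
    ∃ s ≤ r, completionTime d b n v ((List.range r).flatMap (roundPackets d N)) ≤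
      s * (n * b) + (((List.range' s (r - s)).flatMap (roundPackets d N)).map v).sum := by
  induction r with
  | zero => exact ⟨0, le_rfl, by simp [completionTime]⟩
  | succ r ih =>
    rw [List.range_succ, List.flatMap_append, completionTime_append, List.flatMap_singleton]
    have h := foldl_le_max_add_sum d b n v (L := roundPackets d N r) (a := r * (n * b))
      (fun q hq => (arrivalTime_of_mem_roundPackets d N b n hq).le) hv
      (completionTime d b n v ((List.range r).flatMap (roundPackets d N)))
    obtain ⟨s, hs, hle⟩ := ih
    rcases max_choice (completionTime d b n v ((List.range r).flatMap (roundPackets d N)))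
      (r * (n * b)) with h' | h' <;> rw [h'] at h
    · refine ⟨s, by lia, h.trans ?_⟩
      rw [Nat.sub_add_comm hs, List.range'_concat, List.flatMap_append, List.map_append,
        List.sum_append, show s + 1 * (r - s) = r by lia, List.flatMap_singleton]
      linarith
    · refine ⟨r, by lia, h.trans ?_⟩
      simp

/-- The departure time is bounded by the time needed from the start of some round on. -/
theorem completionTime_servedUpTo_le (hv : ∀ q, 0 ≤ v q) {p : Packet η} (hp : 1 ≤ p.2.2) :
    ∃ r ≤ roundOf d p, completionTime d b n v (servedUpTo d N p) ≤
      r * (n * b) + ((servedFrom d N p r).map v).sum := by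
  rw [servedUpTo, completionTime_append]
  have h := foldl_le_max_add_sum d b n v (L := roundUpTo d N p) (a := roundOf d p * (n * b))
      (fun q hq => by
        rw [arrivalTime_eq d b n (one_le_of_mem_roundUpTo d N hp hq),
          roundOf_of_mem_roundUpTo d N hq]) hv
      (completionTime d b n v ((List.range (roundOf d p)).flatMap (roundPackets d N)))
  obtain ⟨s, hs, hle⟩ := completionTime_rounds_le d N b n v hv (roundOf d p)
  rcases max_choice
    (completionTime d b n v ((List.range (roundOf d p)).flatMap (roundPackets d N)))
      (roundOf d p * (n * b)) with h' | h' <;> rw [h'] at h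
  · refine ⟨s, hs, h.trans ?_⟩
    rw [servedFrom, List.map_append, List.sum_append]
    linarith
  · refine ⟨roundOf d p, le_rfl, h.trans ?_⟩
    simp [servedFrom]

/-- Round `r` cannot start before its packets arrive, and all later waiting is dropped. Nonempty
rounds ensure that the first packet of the list does belong to round `r`. -/
theorem le_completionTime_servedUpTo {p : Packet η} (hp : 1 ≤ p.2.2)
    (hne : ∀ r, roundPackets d N r ≠ []) {r : ℕ} (hr : r ≤ roundOf d p) :
    r * (n * b) + ((servedFrom d N p r).map v).sum ≤
      completionTime d b n v (servedUpTo d N p) := by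
  rw [servedUpTo_eq_append d N p hr, completionTime_append]
  apply arrival_add_sum_le_foldl
  · simp [servedFrom, roundUpTo]
  · intro q hq
    rcases hr.eq_or_lt with h | h
    · have hq' : q ∈ roundUpTo d N p := by
        have := List.mem_of_mem_head? hq
        simpa [servedFrom, h] using this
      rw [arrivalTime_eq d b n (one_le_of_mem_roundUpTo d N hp hq'),
        roundOf_of_mem_roundUpTo d N hq', h]
    · rw [servedFrom_of_lt d N p h, List.head?_append_of_ne_nil _ (hne r)] at hq
      rw [arrivalTime_of_mem_roundPackets d N b n (List.mem_of_mem_head? hq)]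

end Queue

/-! ### Counting the transmitted packets -/

section Length

theorem length_roundPackets (r : ℕ) :
    (roundPackets d N r).length = ∑ g with r % d g = 0, N g := by
  simp only [roundPackets, List.length_flatMap, List.length_map, List.length_range]
  rw [← List.sum_toFinset _ ((List.nodup_finRange η).filter _)]
  congr 1
  ext g
  simp

theorem length_servedFrom (p : Packet η) (r : ℕ) :
    (servedFrom d N p r).length =
      ∑ s ∈ Finset.Ico r (roundOf d p), (∑ g with s % d g = 0, N g) +
        (roundUpTo d N p).length := by
  rw [servedFrom, List.length_append, List.length_flatMap]
  simp only [length_roundPackets]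
  rw [← List.sum_toFinset _ (List.nodup_range' (h := by norm_num))]
  congr 2
  ext s
  simp only [List.mem_toFinset, List.mem_range'_1, Finset.mem_Ico]
  lia

/-- The packet is the `i`-th of the block of group `g`, which follows the blocks of the smaller
groups served in the round. As no packet repeats, `takeWhile` runs through all of its predecessors.
-/
theorem length_roundUpTo (hd : ∀ g, 0 < d g) {g : Fin η} {i k : ℕ} (hi : 1 ≤ i) (hk : 1 ≤ k)
    (hiN : i ≤ N g) :
    (roundUpTo d N (g, i, k)).length =
      ∑ j with j < g ∧ roundOf d (g, i, k) % d j = 0, N j + i := by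
  set R := roundOf d (g, i, k) with hR
  have hRg : R % d g = 0 := by simp [hR, roundOf]
  have hRk : R / d g + 1 = k := by
    simp only [hR, roundOf]
    rw [Nat.mul_div_cancel_left _ (hd g)]; lia
  have hmem : g ∈ (List.finRange η).filter fun j => R % d j = 0 := by simp [hRg]
  obtain ⟨l₁, l₂, hl⟩ := List.append_of_mem hmem
  have hsort : ((List.finRange η).filter fun j => R % d j = 0).Pairwise (· < ·) :=
    (List.pairwise_lt_finRange η).filter _
  rw [hl, List.pairwise_append, List.pairwise_cons] at hsort
  obtain ⟨s1, ⟨s2, -⟩, s3⟩ := hsort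
  have hl1 : ∀ j, j ∈ l₁ ↔ j < g ∧ R % d j = 0 := by
    intro j
    have hj : j ∈ ((List.finRange η).filter fun j => R % d j = 0) ↔ R % d j = 0 := by simp
    rw [hl] at hj
    simp only [List.mem_append, List.mem_cons] at hj
    constructor
    · intro h
      exact ⟨s3 j h g (by simp), hj.1 (Or.inl h)⟩
    · rintro ⟨h, h'⟩
      rcases hj.2 h' with h'' | h'' | h''
      · exact h''
      · exact absurd h (by simp [h''])
      · exact absurd h (not_lt.2 (s2 j h'').le)
  have hrange : List.range (N g) = List.range (i - 1) ++ (i - 1) :: List.range' i (N g - i) := by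
    have h1 : N g = (i - 1) + ((N g - i) + 1) := by lia
    conv_lhs => rw [h1]
    rw [List.range_eq_range', ← List.range'_append_1, List.range'_succ, List.range_eq_range']
    congr 3
    all_goals lia
  set A : List (Packet η) :=
    (l₁.flatMap fun j => (List.range (N j)).map fun i => (j, i + 1, R / d j + 1)) ++
      (List.range (i - 1)).map fun i => (g, i + 1, R / d g + 1) with hA
  have hB : ∃ C, roundPackets d N R = A ++ (g, i, k) :: C := by
    rw [roundPackets, hl, List.flatMap_append, List.flatMap_cons, hrange, List.map_append,
      List.map_cons, show i - 1 + 1 = i by lia, hRk, hA, hRk]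
    simp only [List.append_assoc, List.cons_append]
    exact ⟨_, rfl⟩
  obtain ⟨C, hC⟩ := hB
  have hAp : ∀ q ∈ A, q ≠ (g, i, k) := by
    have := nodup_roundPackets d N R
    rw [hC, List.nodup_append] at this
    intro q hq
    exact this.2.2 q hq _ (by simp)
  have htake : roundUpTo d N (g, i, k) = A ++ [(g, i, k)] := by
    rw [roundUpTo, ← hR, hC, List.takeWhile_append_of_pos (by simpa using hAp)]
    simp
  rw [htake, hA]
  simp only [List.length_append, List.length_flatMap, List.length_map, List.length_range,
    List.length_cons, List.length_nil]
  rw [← List.sum_toFinset _ s1.nodup, add_assoc]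
  congr 1
  · congr 1
    ext j
    simp [hl1]
  · lia

end Length

end Schedule

/-! ### Decay rates as exponential bounds, including probability zero -/

section ExtendedReal

theorem coe_le_neg_log_div_iff {q : ENNReal} {t B : ℝ} (ht : 0 < t) :
    (B : EReal) ≤ -(ENNReal.log q / (t : EReal)) ↔ q ≤ ENNReal.ofReal (Real.exp (-(B * t))) := by
  rw [EReal.le_neg, EReal.div_le_iff_le_mul (by exact_mod_cast ht) (EReal.coe_ne_top _),
    ← ENNReal.log_le_log_iff, ENNReal.log_ofReal_of_pos (Real.exp_pos _), Real.log_exp,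
    ← EReal.coe_neg, ← EReal.coe_mul]
  ring_nf

theorem neg_log_div_le_coe_iff {q : ENNReal} {t B : ℝ} (ht : 0 < t) :
    -(ENNReal.log q / (t : EReal)) ≤ (B : EReal) ↔ ENNReal.ofReal (Real.exp (-(B * t))) ≤ q := by
  rw [EReal.neg_le, EReal.le_div_iff_mul_le (by exact_mod_cast ht) (EReal.coe_ne_top _),
    ← ENNReal.log_le_log_iff, ENNReal.log_ofReal_of_pos (Real.exp_pos _), Real.log_exp,
    ← EReal.coe_neg, ← EReal.coe_mul]
  ring_nf

end ExtendedReal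

/-! ### The rate function -/

section RateFunction

variable {ν : Measure ℝ}

theorem rateFunction_le_iff {c y : ℝ} {B : EReal} :
    rateFunction ν c y ≤ B ↔
      ∀ θ, 0 < θ → θ ∈ integrableExpSet id ν → ((θ * y - c * cgf id ν θ : ℝ) : EReal) ≤ B := by
  simp [rateFunction, iSup_le_iff]

theorem lt_rateFunction_iff {c y : ℝ} {B : EReal} :
    B < rateFunction ν c y ↔
      ∃ θ, 0 < θ ∧ θ ∈ integrableExpSet id ν ∧ B < ((θ * y - c * cgf id ν θ : ℝ) : EReal) := by
  simp [rateFunction, lt_iSup_iff, and_assoc]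

theorem le_rateFunction {c y θ : ℝ} (hθ : 0 < θ) (h : θ ∈ integrableExpSet id ν) :
    ((θ * y - c * cgf id ν θ : ℝ) : EReal) ≤ rateFunction ν c y :=
  rateFunction_le_iff.1 le_rfl θ hθ h

theorem cgf_nonneg_of_nonneg [IsProbabilityMeasure ν] (hν : ∀ᵐ v ∂ν, 0 ≤ v) {θ : ℝ}
    (hθ : 0 < θ) (h : θ ∈ integrableExpSet id ν) : 0 ≤ cgf id ν θ := by
  apply Real.log_nonneg
  have : ∫ _, (1 : ℝ) ∂ν ≤ mgf id ν θ := by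
    refine integral_mono_ae (integrable_const _) h ?_
    filter_upwards [hν] with v hv
    exact Real.one_le_exp (mul_nonneg hθ.le hv)
  simpa using this

/-- Each θy - cΛ(θ) is monotone in this way, because θ > 0 and Λ(θ) ≥ 0 for nonnegative transmission
times. -/
theorem rateFunction_mono [IsProbabilityMeasure ν] (hν : ∀ᵐ v ∂ν, 0 ≤ v) {c c' y y' : ℝ}
    (hc : c' ≤ c) (hy : y ≤ y') : rateFunction ν c y ≤ rateFunction ν c' y' := by
  refine rateFunction_le_iff.2 fun θ hθ h => le_trans ?_ (le_rateFunction hθ h)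
  have := cgf_nonneg_of_nonneg hν hθ h
  rw [EReal.coe_le_coe_iff]
  gcongr

/-- Absorbs the prefactor ℓ' of the γ's, so that they become values of the rate function comparable
by monotonicity. -/
theorem mul_rateFunction {l : ℝ} (hl : 0 < l) (c y : ℝ) :
    (l : EReal) * rateFunction ν c y = rateFunction ν (l * c) (l * y) := by
  refine eq_of_forall_ge_iff fun B => ?_
  rw [mul_comm, ← EReal.le_div_iff_mul_le (by exact_mod_cast hl) (EReal.coe_ne_top _),
    rateFunction_le_iff, rateFunction_le_iff]
  refine forall₃_congr fun θ _ _ => ?_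
  rw [EReal.le_div_iff_mul_le (by exact_mod_cast hl) (EReal.coe_ne_top _), ← EReal.coe_mul]
  ring_nf

/-- Let θ decrease to 0 in θy; this matters for y < 0. -/
theorem rateFunction_zero_nonneg [IsFiniteMeasure ν]
    (hmgf : ∃ θ : ℝ, 0 < θ ∧ θ ∈ integrableExpSet id ν) (y : ℝ) : 0 ≤ rateFunction ν 0 y := by
  obtain ⟨θ, hθ, h⟩ := hmgf
  refine EReal.ge_of_forall_gt_iff_ge.1 fun z hz => ?_
  have hz' : z < 0 := by exact_mod_cast hz
  obtain ⟨t, ht, htz⟩ : ∃ t ∈ Set.Ioo 0 θ, z < t * y := by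
    have hc : ContinuousAt (fun t : ℝ => t * y) 0 := by fun_prop
    have h1 : ∀ᶠ t in 𝓝[>] (0 : ℝ), z < t * y :=
      nhdsWithin_le_nhds (hc.eventually_const_lt (by simpa))
    obtain ⟨t, h⟩ := (h1.and (Ioo_mem_nhdsGT hθ)).exists
    exact ⟨t, h.2, h.1⟩
  refine le_trans ?_ (le_rateFunction ht.1
    (integrable_exp_mul_of_nonneg_of_le h ht.1.le ht.2.le))
  rw [EReal.coe_le_coe_iff]
  linarith

/-- An exponential bound on the tail along an arithmetic progression gives finite exponential
moments. -/
theorem mem_integrableExpSet_of_tail [IsProbabilityMeasure ν] (hν : ∀ᵐ v ∂ν, 0 ≤ v) {h s : ℝ}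
    (hh : 0 < h) (htail : ∀ᶠ j : ℕ in atTop, ν.real (Set.Ici (j * h)) ≤ Real.exp (-(s * (j * h))))
    {θ : ℝ} (hθ : 0 < θ) (hs : θ < s) : θ ∈ integrableExpSet id ν := by
  have hsum : Summable fun j : ℕ => ν.real (Set.Ici (j * h)) * Real.exp (θ * ((j + 1) * h)) := by
    have hgeo : Summable fun j : ℕ => Real.exp (θ * h) * Real.exp (-((s - θ) * h)) ^ j :=
      (summable_geometric_of_lt_one (Real.exp_pos _).le (by
        rw [Real.exp_lt_one_iff]
        have := mul_pos (sub_pos.2 hs) hh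
        linarith)).mul_left _
    refine hgeo.of_norm_bounded_eventually_nat ?_
    filter_upwards [htail] with j hj
    rw [Real.norm_of_nonneg (by positivity)]
    calc ν.real (Set.Ici (j * h)) * Real.exp (θ * ((j + 1) * h))
        ≤ Real.exp (-(s * (j * h))) * Real.exp (θ * ((j + 1) * h)) := by gcongr
      _ = _ := by
        rw [← Real.exp_nat_mul, ← Real.exp_add, ← Real.exp_add]
        ring_nf
  refine ⟨by fun_prop, ?_⟩
  rw [hasFiniteIntegral_iff_ofReal (ae_of_all _ fun _ => (Real.exp_pos _).le)]
  -- On the cell [jh, (j+1)h) the integrand is at most its value at the right end, and the cell is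
  -- enlarged to [jh, ∞); the resulting series is dominated by a geometric one with ratio exp (-(s -
  -- θ)h).
  calc ∫⁻ v, ENNReal.ofReal (Real.exp (θ * id v)) ∂ν
      ≤ ∫⁻ v, ∑' j : ℕ, (Set.Ici ((j : ℝ) * h)).indicator
          (fun _ => ENNReal.ofReal (Real.exp (θ * ((j + 1) * h)))) v ∂ν := by
        refine lintegral_mono_ae ?_
        filter_upwards [hν] with v hv
        have h1 : (⌊v / h⌋₊ : ℝ) * h ≤ v :=
          (le_div_iff₀ hh).1 (Nat.floor_le (div_nonneg hv hh.le))
        have h2 : v ≤ ((⌊v / h⌋₊ : ℝ) + 1) * h :=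
          ((div_lt_iff₀ hh).1 (Nat.lt_floor_add_one (v / h))).le
        refine le_trans ?_ (ENNReal.le_tsum ⌊v / h⌋₊)
        rw [Set.indicator_of_mem (by exact h1)]
        exact ENNReal.ofReal_le_ofReal (Real.exp_le_exp.2 (mul_le_mul_of_nonneg_left h2 hθ.le))
    _ = ∑' j : ℕ, ENNReal.ofReal (ν.real (Set.Ici (j * h)) * Real.exp (θ * ((j + 1) * h))) := by
        rw [lintegral_tsum fun j => (measurable_const.indicator measurableSet_Ici).aemeasurable]
        congr with j
        rw [lintegral_indicator_const measurableSet_Ici, mul_comm,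
          ENNReal.ofReal_mul measureReal_nonneg, ofReal_measureReal]
    _ < ⊤ := hsum.tsum_ofReal_lt_top

/-- At c = 0 the rate function is the supremum of θy over the θ with Λ(θ) < ∞, and the tail bound
admits every positive θ < s. A progression suffices, which is needed because `n` runs only through
admissible values. -/
theorem coe_mul_le_rateFunction_zero [IsProbabilityMeasure ν] (hν : ∀ᵐ v ∂ν, 0 ≤ v)
    (hmgf : ∃ θ : ℝ, 0 < θ ∧ θ ∈ integrableExpSet id ν) {h s y : ℝ} (hh : 0 < h) (hy : 0 < y)
    (htail : ∀ᶠ j : ℕ in atTop,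
      ν (Set.Ici (j * h)) ≤ ENNReal.ofReal (Real.exp (-(s * (j * h))))) :
    ((s * y : ℝ) : EReal) ≤ rateFunction ν 0 y := by
  refine EReal.ge_of_forall_gt_iff_ge.1 fun z hz => ?_
  rcases le_or_gt z 0 with h0 | h0
  · exact le_trans (by exact_mod_cast h0) (rateFunction_zero_nonneg hmgf y)
  · have hzs : z / y < s := by
      rw [div_lt_iff₀ hy]
      exact_mod_cast hz
    refine le_trans (le_of_eq ?_) (le_rateFunction (div_pos h0 hy)
      (mem_integrableExpSet_of_tail hν hh ?_ (div_pos h0 hy) hzs))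
    · rw [div_mul_cancel₀ _ hy.ne']
      simp
    · filter_upwards [htail] with j hj
      exact ENNReal.toReal_le_of_le_ofReal (Real.exp_pos _).le hj

end RateFunction

/-! ### Large deviations of sums of transmission times -/

section Sums

theorem ae_forall_nonneg {Ω ι : Type*} [MeasurableSpace Ω] [Countable ι] {P : Measure Ω}
    {ν : Measure ℝ} {V : ι → Ω → ℝ} (hν : ∀ᵐ v ∂ν, 0 ≤ v)
    (hV_meas : ∀ q, Measurable (V q)) (hV_law : ∀ q, P.map (V q) = ν) :
    ∀ᵐ ω ∂P, ∀ q, 0 ≤ V q ω := by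
  refine ae_all_iff.2 fun q => ?_
  have : ∀ᵐ v ∂(P.map (V q)), 0 ≤ v := by rw [hV_law]; exact hν
  exact ae_of_ae_map (hV_meas q).aemeasurable this

variable {Ω : Type*} [MeasurableSpace Ω] {P : Measure Ω} [IsProbabilityMeasure P] {η : ℕ}
  {ν : Measure ℝ} {V : Packet η → Ω → ℝ}

theorem measure_le_sum_eq_pi (hV_meas : ∀ q, Measurable (V q)) (hV_law : ∀ q, P.map (V q) = ν)
    (hV_indep : iIndepFun V P) {L : List (Packet η)} (hL : L.Nodup) (z : ℝ) :
    P {ω | z ≤ (L.map fun q => V q ω).sum} =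
      (Measure.pi fun _ : Fin L.length => ν) {x | z ≤ ∑ i, x i} := by
  have h := (iIndepFun_iff_map_fun_eq_pi_map (fun i => (hV_meas (L.get i)).aemeasurable)).1
    (hV_indep.precomp (List.nodup_iff_injective_get.1 hL))
  simp only [hV_law] at h
  rw [← h, Measure.map_apply (measurable_pi_lambda _ fun i => hV_meas _)
    (measurableSet_le measurable_const (by fun_prop))]
  congr 1
  ext ω
  have : (L.map fun q => V q ω).sum = ∑ i, V (L.get i) ω := by
    conv_lhs => rw [← List.ofFn_get L, List.map_ofFn, List.sum_ofFn]
    rfl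
  simp [this]

variable [IsProbabilityMeasure ν]

/-- **Chernoff's bound** for the transmission times of a list of packets. -/
theorem measure_le_sum_le (hV_meas : ∀ q, Measurable (V q)) (hV_law : ∀ q, P.map (V q) = ν)
    (hV_indep : iIndepFun V P) {L : List (Packet η)} (hL : L.Nodup) {θ : ℝ} (hθ : 0 ≤ θ)
    (hint : θ ∈ integrableExpSet id ν) (z : ℝ) :
    P.real {ω | z ≤ (L.map fun q => V q ω).sum} ≤
      Real.exp (-(θ * z - L.length * cgf id ν θ)) := by
  have hs : (fun ω => (L.map fun q => V q ω).sum) = ∑ q ∈ L.toFinset, V q := by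
    ext ω
    rw [Finset.sum_apply, List.sum_toFinset _ hL]
  have hVint : ∀ q, Integrable (fun ω => Real.exp (θ * V q ω)) P := by
    intro q
    have : Integrable (fun v : ℝ => Real.exp (θ * v)) (P.map (V q)) := by
      rw [hV_law]; exact hint
    exact this.comp_measurable (hV_meas q)
  have h := measure_ge_le_exp_mul_mgf (μ := P) (X := ∑ q ∈ L.toFinset, V q) z hθ
    (hV_indep.integrable_exp_mul_sum hV_meas fun q _ => hVint q)
  rw [hV_indep.mgf_sum hV_meas] at h
  have hm : ∀ q, mgf (V q) P θ = mgf id ν θ := by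
    intro q
    rw [← hV_law q, mgf_id_map (hV_meas q).aemeasurable]
  simp only [hm, Finset.prod_const, List.toFinset_card_of_nodup hL] at h
  rw [← hs] at h
  refine h.trans_eq ?_
  rw [← exp_cgf hint, ← Real.exp_nat_mul, ← Real.exp_add]
  ring_nf

variable {l : Filter ℕ}

/-- The decay rate of the sums of about `c n` transmission times is at least the rate function. -/
theorem eventually_measure_le_sum_le (hl : Tendsto id l atTop)
    (hV_meas : ∀ q, Measurable (V q)) (hV_law : ∀ q, P.map (V q) = ν)
    (hV_indep : iIndepFun V P) {L : ℕ → List (Packet η)} (hL : ∀ n, (L n).Nodup) {c y B : ℝ}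
    (hc : Tendsto (fun n => ((L n).length : ℝ) / n) l (𝓝 c))
    (hB : (B : EReal) < rateFunction ν c y) :
    ∀ᶠ n : ℕ in l, P.real {ω | n * y ≤ ((L n).map fun q => V q ω).sum} ≤ Real.exp (-(B * n)) := by
  obtain ⟨θ, hθ, hint, hlt⟩ := lt_rateFunction_iff.1 hB
  rw [EReal.coe_lt_coe_iff] at hlt
  have hlim : Tendsto (fun n : ℕ => θ * y - ((L n).length : ℝ) / n * cgf id ν θ) l
      (𝓝 (θ * y - c * cgf id ν θ)) := (hc.mul_const _).const_sub _
  filter_upwards [hlim.eventually_const_lt hlt, hl.eventually_gt_atTop 0] with n hn hn0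
  refine (measure_le_sum_le hV_meas hV_law hV_indep (hL n) hθ.le hint _).trans ?_
  have hn0' : (0 : ℝ) < n := by exact_mod_cast hn0
  rw [Real.exp_le_exp, neg_le_neg_iff]
  calc B * n ≤ (θ * y - ((L n).length : ℝ) / n * cgf id ν θ) * n := by gcongr
    _ = _ := by field_simp

/-- The decay rate of the sums of at least `c n` transmission times is at most the rate
function. -/
theorem eventually_le_measure_le_sum (hl : Tendsto id l atTop) (hν : ∀ᵐ v ∂ν, 0 ≤ v)
    (hmgf : ∃ θ : ℝ, 0 < θ ∧ θ ∈ integrableExpSet id ν)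
    (hV_meas : ∀ q, Measurable (V q)) (hV_law : ∀ q, P.map (V q) = ν)
    (hV_indep : iIndepFun V P) {L : ℕ → List (Packet η)} (hL : ∀ n, (L n).Nodup) {c y B : ℝ}
    (hc0 : 0 < c) {i : ℕ} (hc : ∀ᶠ n : ℕ in l, ((L n).length : ℝ) = c * n + i)
    (hB : rateFunction ν c y < (B : EReal)) :
    ∀ᶠ n : ℕ in l, Real.exp (-(B * n)) ≤ P.real {ω | n * y ≤ ((L n).map fun q => V q ω).sum} := by
  obtain ⟨B', hB', hBB'⟩ := EReal.lt_iff_exists_real_btwn.1 hB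
  rw [EReal.coe_lt_coe_iff] at hBB'
  have hcr := cramer_lower_bound ν hν hmgf (a := y / c) (B := B' / c) (fun θ hθ h => by
    have := rateFunction_le_iff.1 hB'.le θ hθ h
    rw [EReal.coe_le_coe_iff] at this
    rw [le_div_iff₀ hc0]
    calc (θ * (y / c) - cgf id ν θ) * c = θ * y - c * cgf id ν θ := by field_simp
      _ ≤ B' := this) (ε := (B - B') / c) (div_pos (sub_pos.2 hBB') hc0)
  have hM : Tendsto (fun n => (L n).length - i) l atTop := by
    rw [← tendsto_natCast_atTop_iff (R := ℝ)]
    have h1 : Tendsto (fun n : ℕ => c * (n : ℝ)) l atTop :=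
      (tendsto_natCast_atTop_atTop.comp hl).const_mul_atTop hc0
    refine h1.congr' ?_
    filter_upwards [hc] with n hn
    have : i ≤ (L n).length := by
      have : (i : ℝ) ≤ (L n).length := by rw [hn]; linarith [mul_nonneg hc0.le (n.cast_nonneg (α := ℝ))]
      exact_mod_cast this
    push_cast [Nat.cast_sub this]
    linarith
  have hVnn := ae_forall_nonneg hν hV_meas hV_law
  filter_upwards [hM.eventually hcr, hc] with n hn hcn
  have hi : i ≤ (L n).length := by
    have : (i : ℝ) ≤ (L n).length := by rw [hcn]; linarith [mul_nonneg hc0.le (n.cast_nonneg (α := ℝ))]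
    exact_mod_cast this
  have hcast : (((L n).length - i : ℕ) : ℝ) = c * n := by
    push_cast [Nat.cast_sub hi]
    linarith
  -- The last `i` terms are discarded, which only lowers the sum. Exactly cn terms remain, so
  -- Cramér's bound at level y/c applies without any rounding error.
  have hlen : ((L n).take ((L n).length - i)).length = (L n).length - i := by simp
  rw [hcast] at hn
  have h1 : c * n * (y / c) = n * y := by field_simp
  have h2 : (B' / c + (B - B') / c) * (c * n) = B * n := by field_simp; ring
  rw [h1, h2, ← hlen, measureReal_def, ← measure_le_sum_eq_pi hV_meas hV_law hV_indep
    ((hL n).sublist (List.take_sublist _ _))] at hn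
  refine hn.trans (ENNReal.toReal_mono (measure_ne_top _ _) (measure_mono_ae ?_))
  filter_upwards [hVnn] with ω hω h
  refine le_trans (show _ ≤ _ from h) ?_
  exact ((List.take_sublist _ (L n)).map _).sum_le_sum fun a ha => by
    obtain ⟨q, -, rfl⟩ := List.mem_map.1 ha
    exact hω q

end Sums

/-! ### Admissible numbers of sources -/

section Admissible

variable {η : ℕ} {α : Fin η → ℚ}

/-- The product of the denominators of the α_g works. Its multiples show that the limit is not
vacuous and supply the progression for the tail argument. -/
theorem exists_pos_forall_mul_mem_admissible (hα : ∀ g, 0 < α g) :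
    ∃ n₀ : ℕ, 0 < n₀ ∧ ∀ j, n₀ * j ∈ admissible α := by
  refine ⟨∏ g, (α g).den, Finset.prod_pos fun g _ => (α g).den_pos, fun j g => ?_⟩
  obtain ⟨c, hc⟩ := Finset.dvd_prod_of_mem (fun g => (α g).den) (Finset.mem_univ g)
  obtain ⟨a, ha⟩ := Int.eq_ofNat_of_zero_le (Rat.num_pos.2 (hα g)).le
  refine ⟨a * c * j, ?_⟩
  have h : α g * (α g).den = a := by
    rw [Rat.mul_den_eq_num, ha]; simp
  rw [hc]
  push_cast
  rw [← h]
  ring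

theorem tendsto_mul_manySources {n₀ : ℕ} (h0 : 0 < n₀) (h : ∀ j, n₀ * j ∈ admissible α) :
    Tendsto (fun j => n₀ * j) atTop (manySources α) :=
  tendsto_inf.2 ⟨tendsto_id.const_mul_atTop' h0, tendsto_principal.2 (Eventually.of_forall h)⟩

theorem manySources_neBot (hα : ∀ g, 0 < α g) : (manySources α).NeBot := by
  obtain ⟨n₀, h0, h⟩ := exists_pos_forall_mul_mem_admissible hα
  exact (tendsto_mul_manySources h0 h).neBot

theorem tendsto_id_manySources : Tendsto id (manySources α) atTop :=
  tendsto_id.mono_left inf_le_left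

theorem eventually_mem_admissible : ∀ᶠ n in manySources α, n ∈ admissible α :=
  mem_inf_of_right (mem_principal_self _)

theorem cast_groupSize {n : ℕ} (hn : n ∈ admissible α) (g : Fin η) :
    (groupSize α n g : ℝ) = α g * n := by
  obtain ⟨N, hN⟩ := hn g
  rw [groupSize, ← hN, Nat.floor_natCast]
  exact_mod_cast hN

theorem eventually_le_groupSize (hα : ∀ g, 0 < α g) (g : Fin η) (i : ℕ) :
    ∀ᶠ n in manySources α, i ≤ groupSize α n g := by
  have h : Tendsto (fun n : ℕ => (α g : ℝ) * n) (manySources α) atTop :=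
    (tendsto_natCast_atTop_atTop.comp tendsto_id_manySources).const_mul_atTop
      (by exact_mod_cast hα g)
  filter_upwards [h.eventually_ge_atTop (i : ℝ), eventually_mem_admissible] with n hn hn'
  rw [← cast_groupSize hn'] at hn
  exact_mod_cast hn

end Admissible

/-! ### The load of consecutive rounds -/

section Load

variable {η : ℕ} (d : Fin η → ℕ) (α : Fin η → ℚ)

/-- The number of packets transmitted in round `r`, divided by `n`. -/
noncomputable def roundLoad (r : ℕ) : ℝ := ∑ j with r % d j = 0, (α j : ℝ)

/-- The number of packets transmitted from the start of round `r` to the start of round `R`,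
divided by `n`. -/
noncomputable def loadFrom (r R : ℕ) : ℝ := ∑ s ∈ Finset.Ico r R, roundLoad d α s

variable {d α}

theorem roundLoad_nonneg (hα : ∀ g, 0 < α g) (r : ℕ) : 0 ≤ roundLoad d α r :=
  Finset.sum_nonneg fun j _ => by exact_mod_cast (hα j).le

theorem roundLoad_pos [NeZero η] (hα : ∀ g, 0 < α g) (hd : d 0 = 1) (r : ℕ) :
    0 < roundLoad d α r :=
  Finset.sum_pos (fun j _ => by exact_mod_cast hα j) ⟨0, by simp [hd, Nat.mod_one]⟩

theorem loadFrom_pos [NeZero η] (hα : ∀ g, 0 < α g) (hd : d 0 = 1) {r R : ℕ} (h : r < R) :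
    0 < loadFrom d α r R :=
  Finset.sum_pos (fun s _ => roundLoad_pos hα hd s) (Finset.nonempty_Ico.2 h)

theorem loadFrom_mono (hα : ∀ g, 0 < α g) (r : ℕ) {R R' : ℕ} (h : R ≤ R') :
    loadFrom d α r R ≤ loadFrom d α r R' :=
  Finset.sum_le_sum_of_subset_of_nonneg (Finset.Ico_subset_Ico_right h)
    fun s _ _ => roundLoad_nonneg hα s

/-- Each window of length `c` contains one multiple of `c`, wherever it starts; hence an iteration
may begin at any round. -/
theorem card_filter_Ico_mod_eq_zero {c : ℕ} (hc : 0 < c) (r m : ℕ) :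
    ((Finset.Ico r (r + m * c)).filter fun s => s % c = 0).card = m := by
  induction m with
  | zero => simp
  | succ m ih =>
    have h1 : ((Finset.Ico (r + m * c) (r + m * c + c)).filter fun s => s % c = 0).card = 1 := by
      rw [Nat.filter_Ico_card_eq_of_periodic _ _ _ (fun s => by simp),
        Nat.count_eq_card_filter_range, Finset.card_eq_one]
      refine ⟨0, ?_⟩
      ext s
      simp only [Finset.mem_filter, Finset.mem_range, Finset.mem_singleton]
      constructor
      · rintro ⟨h, h'⟩
        rwa [Nat.mod_eq_of_lt h] at h'
      · rintro rfl
        exact ⟨hc, Nat.zero_mod c⟩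
    have h2 : r + (m + 1) * c = r + m * c + c := by ring
    rw [h2, ← Finset.Ico_union_Ico_eq_Ico (a := r) (b := r + m * c) (by lia) (by lia),
      Finset.filter_union, Finset.card_union_of_disjoint
        (Finset.disjoint_filter_filter (Finset.Ico_disjoint_Ico_consecutive _ _ _)), ih, h1]

theorem iterLength_pos (hd : ∀ g, 0 < d g) : 0 < iterLength d := by
  refine Nat.pos_of_ne_zero fun h => ?_
  obtain ⟨g, -, hg⟩ := Finset.lcm_eq_zero_iff.1 h
  exact (hd g).ne' hg

/-- Every iteration has the same load. -/
theorem loadFrom_iter (hd : ∀ g, 0 < d g) (r l : ℕ) :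
    loadFrom d α r (r + l * iterLength d) = l * iterLoad d α := by
  simp only [loadFrom, roundLoad, Finset.sum_filter]
  rw [Finset.sum_comm, iterLoad, Finset.mul_sum]
  refine Finset.sum_congr rfl fun j _ => ?_
  obtain ⟨c, hc⟩ : d j ∣ iterLength d := Finset.dvd_lcm (Finset.mem_univ j)
  have h : r + l * iterLength d = r + l * c * d j := by rw [hc]; ring
  rw [← Finset.sum_filter, Finset.sum_const, h, card_filter_Ico_mod_eq_zero (hd j), hc]
  have : (d j : ℝ) ≠ 0 := by exact_mod_cast (hd j).ne'
  push_cast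
  field_simp
  simp

theorem loadFrom_le (hα : ∀ g, 0 < α g) (hd : ∀ g, 0 < d g) {r R l : ℕ}
    (h : R ≤ r + l * iterLength d) : loadFrom d α r R ≤ l * iterLoad d α :=
  (loadFrom_mono hα r h).trans_eq (loadFrom_iter hd r l)

theorem le_loadFrom (hα : ∀ g, 0 < α g) (hd : ∀ g, 0 < d g) {r R l : ℕ}
    (h : r + l * iterLength d ≤ R) : l * iterLoad d α ≤ loadFrom d α r R :=
  (loadFrom_iter hd r l).symm.trans_le (loadFrom_mono hα r h)

theorem limitRatio_nonneg (hα : ∀ g, 0 < α g) (p : Packet η) : 0 ≤ limitRatio d α p :=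
  Finset.sum_nonneg fun j _ => by exact_mod_cast (hα j).le

theorem limitRatio_pos [NeZero η] (hα : ∀ g, 0 < α g) (hd : d 0 = 1) {p : Packet η}
    (hp : p.1 ≠ 0) : 0 < limitRatio d α p :=
  Finset.sum_pos (fun j _ => by exact_mod_cast hα j)
    ⟨0, by simp [hd, Nat.mod_one, Fin.pos_iff_ne_zero, hp]⟩

theorem limitRatio_of_eq_zero [NeZero η] {p : Packet η} (hp : p.1 = 0) :
    limitRatio d α p = 0 := by
  simp [limitRatio, hp]

theorem cast_length_roundUpTo (hd : ∀ g, 0 < d g) {g : Fin η} {i k n : ℕ} (hi : 1 ≤ i)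
    (hk : 1 ≤ k) (hn : n ∈ admissible α) (hiN : i ≤ groupSize α n g) :
    ((roundUpTo d (groupSize α n) (g, i, k)).length : ℝ) = limitRatio d α (g, i, k) * n + i := by
  rw [length_roundUpTo d _ hd hi hk hiN]
  push_cast
  simp only [cast_groupSize hn, limitRatio, Finset.sum_mul]

theorem cast_length_servedFrom (hd : ∀ g, 0 < d g) {g : Fin η} {i k n : ℕ} (hi : 1 ≤ i)
    (hk : 1 ≤ k) (hn : n ∈ admissible α) (hiN : i ≤ groupSize α n g) (r : ℕ) :
    ((servedFrom d (groupSize α n) (g, i, k) r).length : ℝ) =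
      (loadFrom d α r (roundOf d (g, i, k)) + limitRatio d α (g, i, k)) * n + i := by
  rw [length_servedFrom]
  push_cast
  rw [cast_length_roundUpTo hd hi hk hn hiN]
  simp only [cast_groupSize hn, loadFrom, roundLoad, Finset.sum_mul, add_mul]
  ring

theorem tendsto_mul_add_div {l : Filter ℕ} (hl : Tendsto id l atTop) {f : ℕ → ℝ} {c a : ℝ}
    (hf : ∀ᶠ n : ℕ in l, f n = c * n + a) : Tendsto (fun n : ℕ => f n / n) l (𝓝 c) := by
  have h : Tendsto (fun n : ℕ => c + a / (n : ℝ)) l (𝓝 (c + 0)) :=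
    ((tendsto_const_nhds.div_atTop tendsto_natCast_atTop_atTop).comp hl).const_add c
  rw [add_zero] at h
  refine h.congr' ?_
  filter_upwards [hf, hl.eventually_gt_atTop 0] with n hn hn0
  have : (n : ℝ) ≠ 0 := by exact_mod_cast (show 0 < n from hn0).ne'
  rw [hn]
  field_simp

end Load

/-! ### Rounding to whole iterations -/

section Gamma

variable {η : ℕ} {d : Fin η → ℕ} {α : Fin η → ℚ} {ν : Measure ℝ} {b : ℝ} {g : Fin η}

theorem gammaU_of_pos (m x : ℝ) {l : ℕ} (hl : 1 ≤ l) :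
    gammaU ν d α b g m x l =
      rateFunction ν (l * iterLoad d α + m) (x + (((l : ℝ) - 1) * iterLength d - d g) * b) := by
  have hl' : (0 : ℝ) < l := by exact_mod_cast hl
  rw [gammaU, if_neg (by lia), mul_rateFunction hl']
  congr 1 <;> field_simp

theorem gammaL_of_pos (m x : ℝ) {l : ℕ} (hl : 1 ≤ l) :
    gammaL ν d α b g m x l =
      rateFunction ν (((l : ℝ) - 1) * iterLoad d α + m)
        (x + ((l : ℝ) * iterLength d - d g) * b) := by
  have hl' : (0 : ℝ) < l := by exact_mod_cast hl
  rw [gammaL, if_neg (by lia), mul_rateFunction hl']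
  congr 1 <;> field_simp

variable [IsProbabilityMeasure ν]

/-- The level that the transmission times from round `r` on, divided by `n`, have to reach. -/
noncomputable def ageLevel (d : Fin η → ℕ) (b x : ℝ) (g : Fin η) (R r : ℕ) : ℝ :=
  x + ((R : ℝ) - r) * b - d g * b

/-- Take l = ⌈(R - r)/d̃⌉: the rounds from `r` to R fit into `l` iterations and span at least l - 1
of them, so the load is overestimated and the level underestimated. For r = R there is equality with
l = 0. -/
theorem exists_gammaU_le (hν : ∀ᵐ v ∂ν, 0 ≤ v) (hα : ∀ g, 0 < α g) (hd : ∀ g, 0 < d g)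
    (hb : 0 < b) (p : Packet η) (m x : ℝ) {r : ℕ} (hr : r ≤ roundOf d p) :
    ∃ l ∈ Finset.Icc 0 (lastIter d p), gammaU ν d α b p.1 m x l ≤
      rateFunction ν (loadFrom d α r (roundOf d p) + m)
        (ageLevel d b x p.1 (roundOf d p) r) := by
  set R := roundOf d p
  have hD : (0 : ℝ) < iterLength d := by exact_mod_cast iterLength_pos hd
  rcases hr.eq_or_lt with h | h
  · refine ⟨0, by simp, ?_⟩
    simp [gammaU, h, loadFrom, ageLevel]
  · set l := ⌈((R : ℝ) - r) / iterLength d⌉₊ with hl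
    have hrR : (0 : ℝ) < R - r := sub_pos.2 (by exact_mod_cast h)
    have hl1 : 1 ≤ l := Nat.ceil_pos.2 (by positivity)
    refine ⟨l, Finset.mem_Icc.2 ⟨zero_le, Nat.ceil_mono (by gcongr; simp [R])⟩, ?_⟩
    rw [gammaU_of_pos _ _ hl1]
    have h1 : (R : ℝ) - r ≤ l * iterLength d := (div_le_iff₀ hD).1 (Nat.le_ceil _)
    have h2 : ((l : ℝ) - 1) * iterLength d ≤ R - r := by
      rw [← le_div_iff₀ hD]
      have := Nat.ceil_lt_add_one (a := ((R : ℝ) - r) / iterLength d) (by positivity)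
      linarith
    apply rateFunction_mono hν
    · gcongr
      refine loadFrom_le hα hd ?_
      have : (R : ℝ) ≤ r + l * iterLength d := by linarith
      exact_mod_cast this
    · rw [ageLevel, add_sub_assoc, ← sub_mul]
      gcongr

/-- Start `l` iterations before R: the load is at least that of l - 1 iterations, and the time span
is at most `l` iterations. -/
theorem exists_le_gammaL (hν : ∀ᵐ v ∂ν, 0 ≤ v) (hα : ∀ g, 0 < α g) (hd : ∀ g, 0 < d g)
    (hb : 0 < b) (p : Packet η) (m x : ℝ) {l : ℕ} (hl : 1 ≤ l) (hl' : l ≤ lastIter d p) :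
    ∃ r < roundOf d p, rateFunction ν (loadFrom d α r (roundOf d p) + m)
        (ageLevel d b x p.1 (roundOf d p) r) ≤ gammaL ν d α b p.1 m x l := by
  set R := roundOf d p
  have hD0 := iterLength_pos hd
  have hD : (0 : ℝ) < iterLength d := by exact_mod_cast hD0
  have h1 : (l - 1) * iterLength d < R := by
    have : l - 1 < ⌈(R : ℝ) / iterLength d⌉₊ := lt_of_lt_of_le (by lia) hl'
    rw [Nat.lt_ceil, lt_div_iff₀ hD] at this
    exact_mod_cast this
  have h2 : (l - 1) * iterLength d + iterLength d = l * iterLength d := by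
    rw [← Nat.succ_mul]; congr 1; lia
  -- Truncated subtraction: when `l` iterations reach back beyond round 0, the start is round 0.
  -- Since l ≤ k', l - 1 full iterations still fit before R.
  refine ⟨R - l * iterLength d, by lia, ?_⟩
  rw [gammaL_of_pos _ _ hl]
  apply rateFunction_mono hν
  · gcongr
    have := le_loadFrom (α := α) hα hd (r := R - l * iterLength d) (R := R) (l := l - 1) (by lia)
    rwa [Nat.cast_sub hl, Nat.cast_one] at this
  · rw [ageLevel, add_sub_assoc, ← sub_mul]
    gcongr
    have : R ≤ (R - l * iterLength d) + l * iterLength d := by lia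
    have : (R : ℝ) ≤ (R - l * iterLength d : ℕ) + l * iterLength d := by exact_mod_cast this
    linarith

end Gamma

/-! ### The event of a large peak age as a union over rounds -/

section Age

variable {η : ℕ} {d : Fin η → ℕ} {α : Fin η → ℚ} {b x : ℝ} {n : ℕ} {v : Packet η → ℝ}
  {p : Packet η}

theorem arrivalTime_sub_one (hp : 1 ≤ p.2.2) :
    arrivalTime d b n p.1 (p.2.2 - 1) = roundOf d p * (n * b) - d p.1 * (n * b) := by
  rw [arrivalTime, roundOf]
  push_cast [Nat.cast_sub hp]
  ring

theorem le_peakAge (hp : 1 ≤ p.2.2) (hne : ∀ r, roundPackets d (groupSize α n) r ≠ []) {r : ℕ}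
    (hr : r ≤ roundOf d p)
    (h : n * ageLevel d b x p.1 (roundOf d p) r ≤
      ((servedFrom d (groupSize α n) p r).map v).sum) :
    n * x ≤ peakAge d α b n v p := by
  have h1 := le_completionTime_servedUpTo d (groupSize α n) b n v hp hne hr
  rw [peakAge, arrivalTime_sub_one hp, departureTime]
  rw [ageLevel] at h
  linarith

theorem exists_le_of_le_peakAge (hv : ∀ q, 0 ≤ v q) (hp : 1 ≤ p.2.2)
    (h : n * x ≤ peakAge d α b n v p) :
    ∃ r ≤ roundOf d p, n * ageLevel d b x p.1 (roundOf d p) r ≤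
      ((servedFrom d (groupSize α n) p r).map v).sum := by
  obtain ⟨r, hr, h1⟩ := completionTime_servedUpTo_le d (groupSize α n) b n v hv hp
  refine ⟨r, hr, ?_⟩
  rw [peakAge, arrivalTime_sub_one hp, departureTime] at h
  rw [ageLevel]
  linarith

theorem roundPackets_ne_nil [NeZero η] {N : Fin η → ℕ} (hd : d 0 = 1) (hN : 1 ≤ N 0) (r : ℕ) :
    roundPackets d N r ≠ [] :=
  List.ne_nil_of_mem (a := (0, 1, r / d 0 + 1))
    ((mem_roundPackets d N).2 ⟨by simp [hd, Nat.mod_one], le_rfl, hN, rfl⟩)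

end Age

/-! ### Bounds on the decay rate -/

section Decay

variable {Ω : Type*} [MeasurableSpace Ω] {P : Measure Ω}
  {η : ℕ} {d : Fin η → ℕ} {α : Fin η → ℚ} {b x : ℝ}
  {ν : Measure ℝ} {V : Packet η → Ω → ℝ} {g : Fin η} {i k : ℕ}

/-- The tail of a single transmission time bounds the decay rate. -/
theorem eventually_decayRate_le_tail [NeZero η] (hν : ∀ᵐ v ∂ν, 0 ≤ v)
    (hα : ∀ g, 0 < α g) (hd0 : d 0 = 1)
    (hV_meas : ∀ q, Measurable (V q)) (hV_law : ∀ q, P.map (V q) = ν) (hk : 1 ≤ k) :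
    ∀ᶠ n : ℕ in manySources α, decayRate P V d α b (g, i, k) x n ≤
      -(ENNReal.log (ν (Set.Ici (n * (x - d g * b)))) / (n : EReal)) := by
  filter_upwards [eventually_le_groupSize hα 0 1] with n hn
  rw [decayRate]
  refine EReal.neg_le_neg_iff.2 (EReal.div_le_div_right_of_nonneg (by simp) (ENNReal.log_le_log ?_))
  rw [← hV_law (g, i, k), Measure.map_apply (hV_meas _) measurableSet_Ici]
  refine measure_mono_ae ?_
  filter_upwards [ae_forall_nonneg hν hV_meas hV_law] with ω hω h
  refine le_peakAge (p := (g, i, k)) hk (roundPackets_ne_nil hd0 hn) le_rfl ?_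
  have h' : n * (x - d g * b) ≤ V (g, i, k) ω := h
  -- The packet itself occurs in the list starting at its own round, and the other terms are
  -- nonnegative.
  have hmem : V (g, i, k) ω ∈ (servedFrom d (groupSize α n) (g, i, k)
      (roundOf d (g, i, k))).map fun q => V q ω :=
    List.mem_map.2 ⟨_, by simp [servedFrom, roundUpTo], rfl⟩
  refine le_trans (le_of_eq_of_le ?_ h') (List.single_le_sum (fun a ha => ?_) _ hmem)
  · simp [ageLevel]
  · obtain ⟨q, -, rfl⟩ := List.mem_map.1 ha
    exact hω q

theorem tendsto_roundRatio (hα : ∀ g, 0 < α g) (hd : ∀ g, 0 < d g) (hi : 1 ≤ i) (hk : 1 ≤ k) :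
    Tendsto (roundRatio d α (g, i, k)) (manySources α) (𝓝 (limitRatio d α (g, i, k))) := by
  refine tendsto_mul_add_div (a := i) tendsto_id_manySources ?_
  filter_upwards [eventually_mem_admissible, eventually_le_groupSize hα g i] with n hn hiN
  exact cast_length_roundUpTo hd hi hk hn hiN

variable [IsProbabilityMeasure P]

theorem coe_le_decayRate_iff {n : ℕ} (hn : 0 < n) {p : Packet η} {B : ℝ} :
    (B : EReal) ≤ decayRate P V d α b p x n ↔
      P.real {ω | n * x ≤ peakAge d α b n (fun q => V q ω) p} ≤ Real.exp (-(B * n)) := by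
  rw [decayRate, ← EReal.coe_natCast, coe_le_neg_log_div_iff (by exact_mod_cast hn),
    ENNReal.le_ofReal_iff_toReal_le (measure_ne_top _ _) (Real.exp_pos _).le, measureReal_def]

theorem decayRate_le_coe_iff {n : ℕ} (hn : 0 < n) {p : Packet η} {B : ℝ} :
    decayRate P V d α b p x n ≤ (B : EReal) ↔
      Real.exp (-(B * n)) ≤ P.real {ω | n * x ≤ peakAge d α b n (fun q => V q ω) p} := by
  rw [decayRate, ← EReal.coe_natCast, neg_log_div_le_coe_iff (by exact_mod_cast hn),
    ENNReal.ofReal_le_iff_le_toReal (measure_ne_top _ _), measureReal_def]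

variable [IsProbabilityMeasure ν]

/-- Union bound over the R + 1 possible starting rounds, each event being bounded by Chernoff at an
exponent B' slightly above the target B; the gap B' - B absorbs the factor R + 1. -/
theorem iInf_gammaU_le_liminf_decayRate (hν : ∀ᵐ v ∂ν, 0 ≤ v)
    (hα : ∀ g, 0 < α g) (hd : ∀ g, 0 < d g) (hb : 0 < b)
    (hV_meas : ∀ q, Measurable (V q)) (hV_law : ∀ q, P.map (V q) = ν) (hV_indep : iIndepFun V P)
    (hi : 1 ≤ i) (hk : 1 ≤ k) :
    (⨅ l ∈ Finset.Icc 0 (lastIter d (g, i, k)),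
        gammaU ν d α b g (limitRatio d α (g, i, k)) x l)
      ≤ liminf (decayRate P V d α b (g, i, k) x) (manySources α) := by
  refine EReal.ge_of_forall_gt_iff_ge.1 fun B hB => le_liminf_of_le (by isBoundedDefault) ?_
  obtain ⟨B', hBB', hB'⟩ := EReal.lt_iff_exists_real_btwn.1 hB
  rw [EReal.coe_lt_coe_iff] at hBB'
  set p : Packet η := (g, i, k)
  set R := roundOf d p
  have hround : ∀ r ∈ Finset.range (R + 1), ∀ᶠ n : ℕ in manySources α,
      P.real {ω | n * ageLevel d b x g R r ≤
        ((servedFrom d (groupSize α n) p r).map fun q => V q ω).sum} ≤ Real.exp (-(B' * n)) := by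
    intro r hr
    obtain ⟨l, hl, hle⟩ := exists_gammaU_le (ν := ν) hν hα hd hb p (limitRatio d α p) x
      (Nat.lt_succ_iff.1 (Finset.mem_range.1 hr))
    refine eventually_measure_le_sum_le tendsto_id_manySources hV_meas hV_law hV_indep
      (fun n => nodup_servedFrom d _ p r) (tendsto_mul_add_div (a := i) tendsto_id_manySources ?_)
      (hB'.trans_le ((iInf₂_le l hl).trans hle))
    filter_upwards [eventually_mem_admissible, eventually_le_groupSize hα g i] with n hn hiN
    exact cast_length_servedFrom hd hi hk hn hiN r
  have hlim : Tendsto (fun n : ℕ => Real.exp (-((B' - B) * n))) (manySources α) (𝓝 0) :=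
    Real.tendsto_exp_neg_atTop_nhds_zero.comp ((tendsto_natCast_atTop_atTop.comp
      tendsto_id_manySources).const_mul_atTop (sub_pos.2 hBB'))
  have hR : (0 : ℝ) < 1 / (R + 1) := by positivity
  filter_upwards [(eventually_all_finset _).2 hround, hlim.eventually_lt_const hR,
    tendsto_id_manySources.eventually_gt_atTop 0] with n hn hn' hn0
  refine (coe_le_decayRate_iff hn0).2 ?_
  calc P.real {ω | n * x ≤ peakAge d α b n (fun q => V q ω) p}
      ≤ P.real (⋃ r ∈ Finset.range (R + 1), {ω | n * ageLevel d b x g R r ≤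
        ((servedFrom d (groupSize α n) p r).map fun q => V q ω).sum}) := by
        refine ENNReal.toReal_mono (measure_ne_top _ _) (measure_mono_ae ?_)
        filter_upwards [ae_forall_nonneg hν hV_meas hV_law] with ω hω h
        obtain ⟨r, hr, h'⟩ := exists_le_of_le_peakAge (p := p) hω hk h
        exact Set.mem_biUnion (by simpa [Nat.lt_succ_iff] using hr) h'
    _ ≤ ∑ r ∈ Finset.range (R + 1), P.real {ω | n * ageLevel d b x g R r ≤
        ((servedFrom d (groupSize α n) p r).map fun q => V q ω).sum} :=
        measureReal_biUnion_finset_le _ _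
    _ ≤ ∑ r ∈ Finset.range (R + 1), Real.exp (-(B' * n)) := Finset.sum_le_sum hn
    _ = (R + 1) * (Real.exp (-((B' - B) * n)) * Real.exp (-(B * n))) := by
        rw [Finset.sum_const, Finset.card_range, nsmul_eq_mul, ← Real.exp_add]
        push_cast
        ring_nf
    _ ≤ (R + 1) * (1 / (R + 1) * Real.exp (-(B * n))) := by gcongr
    _ = Real.exp (-(B * n)) := by field_simp

theorem measure_servedFrom_le_measure_peakAge [NeZero η] (hd0 : d 0 = 1) {n : ℕ} {p : Packet η}
    (hp : 1 ≤ p.2.2) (hn : 1 ≤ groupSize α n 0) {r : ℕ} (hr : r ≤ roundOf d p) :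
    P.real {ω | n * ageLevel d b x p.1 (roundOf d p) r ≤
        ((servedFrom d (groupSize α n) p r).map fun q => V q ω).sum} ≤
      P.real {ω | n * x ≤ peakAge d α b n (fun q => V q ω) p} :=
  measureReal_mono fun _ h => le_peakAge hp (roundPackets_ne_nil hd0 hn) hr h

/-- The upper bound on the decay rate for the packets from round `r` on, if their number is of
the order of `n`. -/
theorem limsup_decayRate_le_rateFunction [NeZero η] (hν : ∀ᵐ v ∂ν, 0 ≤ v)
    (hmgf : ∃ θ : ℝ, 0 < θ ∧ θ ∈ integrableExpSet id ν)
    (hα : ∀ g, 0 < α g) (hd : ∀ g, 0 < d g) (hd0 : d 0 = 1)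
    (hV_meas : ∀ q, Measurable (V q)) (hV_law : ∀ q, P.map (V q) = ν) (hV_indep : iIndepFun V P)
    (hi : 1 ≤ i) (hk : 1 ≤ k) {r : ℕ} (hr : r ≤ roundOf d (g, i, k))
    (hpos : 0 < loadFrom d α r (roundOf d (g, i, k)) + limitRatio d α (g, i, k)) :
    limsup (decayRate P V d α b (g, i, k) x) (manySources α) ≤
      rateFunction ν (loadFrom d α r (roundOf d (g, i, k)) + limitRatio d α (g, i, k))
        (ageLevel d b x g (roundOf d (g, i, k)) r) := by
  refine EReal.le_of_forall_lt_iff_le.1 fun B hB => limsup_le_of_le (by isBoundedDefault) ?_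
  have hlen : ∀ᶠ n : ℕ in manySources α,
      ((servedFrom d (groupSize α n) (g, i, k) r).length : ℝ) =
        (loadFrom d α r (roundOf d (g, i, k)) + limitRatio d α (g, i, k)) * n + i := by
    filter_upwards [eventually_mem_admissible, eventually_le_groupSize hα g i] with n hn hiN
    exact cast_length_servedFrom hd hi hk hn hiN r
  filter_upwards [eventually_le_measure_le_sum tendsto_id_manySources hν hmgf hV_meas hV_law
    hV_indep (fun n => nodup_servedFrom d (groupSize α n) (g, i, k) r) hpos hlen hB,
    eventually_le_groupSize hα 0 1, tendsto_id_manySources.eventually_gt_atTop 0] with n hn h1 hn0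
  refine (decayRate_le_coe_iff hn0).2 ?_
  exact hn.trans (measure_servedFrom_le_measure_peakAge hd0 (p := (g, i, k)) hk h1 hr)

/-- At a nonpositive level the tail probability is 1, so its rate is 0. -/
theorem neg_log_tail_div_le_rateFunction (hν : ∀ᵐ v ∂ν, 0 ≤ v)
    (hmgf : ∃ θ : ℝ, 0 < θ ∧ θ ∈ integrableExpSet id ν) {y : ℝ} (hy : y ≤ 0) (n : ℕ) :
    -(ENNReal.log (ν (Set.Ici (n * y))) / (n : EReal)) ≤ rateFunction ν 0 y := by
  have h : ν (Set.Ici (n * y)) = 1 := by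
    rw [prob_compl_eq_zero_iff measurableSet_Ici |>.symm]
    refine measure_mono_null ?_ (ae_iff.1 hν)
    intro v hv hv'
    exact hv (le_trans (mul_nonpos_of_nonneg_of_nonpos n.cast_nonneg hy) hv')
  rw [h]
  simpa using rateFunction_zero_nonneg hmgf y

/-- If B is below the liminf, the tail has exponent B/y along the progression n₀jy, which already
forces B ≤ I_0(y). -/
theorem liminf_tail_le_rateFunction (hν : ∀ᵐ v ∂ν, 0 ≤ v)
    (hmgf : ∃ θ : ℝ, 0 < θ ∧ θ ∈ integrableExpSet id ν) (hα : ∀ g, 0 < α g) {y : ℝ} (hy : 0 < y) :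
    liminf (fun n : ℕ => -(ENNReal.log (ν (Set.Ici (n * y))) / (n : EReal))) (manySources α) ≤
      rateFunction ν 0 y := by
  refine EReal.ge_of_forall_gt_iff_ge.1 fun B hB => ?_
  obtain ⟨n₀, h0, h⟩ := exists_pos_forall_mul_mem_admissible hα
  have hev := (tendsto_mul_manySources h0 h).eventually
    ((eventually_lt_of_lt_liminf hB).and (tendsto_id_manySources.eventually_gt_atTop 0))
  have h0' : (0 : ℝ) < n₀ := by exact_mod_cast h0
  rw [← div_mul_cancel₀ B hy.ne']
  refine coe_mul_le_rateFunction_zero hν hmgf (mul_pos h0' hy) hy ?_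
  filter_upwards [hev] with j hj
  have hj0 : (0 : ℝ) < (n₀ * j : ℕ) := by exact_mod_cast hj.2
  have := hj.1.le
  rw [← EReal.coe_natCast, coe_le_neg_log_div_iff hj0] at this
  convert this using 3
  · push_cast; ring
  · push_cast; field_simp

/-- A limsup yields the tail bound only for infinitely many `n`. The existence of the limit `R`
turns this into B'/y ≤ R, hence into a bound with any smaller exponent at all large integers. -/
theorem limsup_tail_le_rateFunction (hν : ∀ᵐ v ∂ν, 0 ≤ v)
    (hmgf : ∃ θ : ℝ, 0 < θ ∧ θ ∈ integrableExpSet id ν) {R : EReal}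
    (hR : Tendsto (fun t : ℝ => -(ENNReal.log (ν (Set.Ici t)) / (t : EReal))) atTop (𝓝 R))
    {y : ℝ} (hy : 0 < y) :
    limsup (fun n : ℕ => -(ENNReal.log (ν (Set.Ici (n * y))) / (n : EReal))) (manySources α) ≤
      rateFunction ν 0 y := by
  refine EReal.ge_of_forall_gt_iff_ge.1 fun B hB => ?_
  obtain ⟨B', hBB', hB'⟩ := EReal.lt_iff_exists_real_btwn.1 hB
  rw [EReal.coe_lt_coe_iff] at hBB'
  have hfreq : ∃ᶠ t : ℝ in atTop,
      ((B' / y : ℝ) : EReal) ≤ -(ENNReal.log (ν (Set.Ici t)) / (t : EReal)) := by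
    have ht : Tendsto (fun n : ℕ => (n : ℝ) * y) (manySources α) atTop :=
      (tendsto_natCast_atTop_atTop.comp tendsto_id_manySources).atTop_mul_const hy
    refine ht.frequently (((frequently_lt_of_lt_limsup (by isBoundedDefault) hB').and_eventually
      (tendsto_id_manySources.eventually_gt_atTop 0)).mono fun n hn => ?_)
    have hn0 : (0 : ℝ) < n := by exact_mod_cast (show 0 < n from hn.2)
    have := hn.1.le
    rw [← EReal.coe_natCast, coe_le_neg_log_div_iff hn0] at this
    rw [coe_le_neg_log_div_iff (mul_pos hn0 hy)]
    convert this using 3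
    field_simp
  have hBR : ((B' / y : ℝ) : EReal) ≤ R := by
    by_contra! hlt
    exact hfreq ((hR.eventually_lt_const hlt).mono fun t ht => not_le.2 ht)
  have hlt : ((B / y : ℝ) : EReal) < R :=
    lt_of_lt_of_le (by rw [EReal.coe_lt_coe_iff]; gcongr) hBR
  rw [← div_mul_cancel₀ B hy.ne']
  refine coe_mul_le_rateFunction_zero hν hmgf one_pos hy ?_
  filter_upwards [(tendsto_natCast_atTop_atTop (R := ℝ)).eventually (hR.eventually_const_lt hlt),
    eventually_gt_atTop 0] with j hj hj0
  have hj0' : (0 : ℝ) < j := by exact_mod_cast hj0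
  rw [mul_one]
  exact (coe_le_neg_log_div_iff hj0').1 hj.le

end Decay

end GRR

/-! ### Assembling the bounds -/

theorem mainTheorem3 {Ω : Type*} [MeasurableSpace Ω] (P : Measure Ω) [IsProbabilityMeasure P]
    {η : ℕ} [NeZero η]
    -- periods and group fractions
    (d : Fin η → ℕ) (hd_mono : StrictMono d) (hd_first : d 0 = 1)
    (α : Fin η → ℚ) (hα_pos : ∀ g, 0 < α g) (hα_sum : ∑ g, α g = 1)
    (b : ℝ) (hb : 0 < b)
    -- i.i.d. nonnegative transmission times with law `ν` and finite moment generating function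
    (ν : Measure ℝ) [IsProbabilityMeasure ν] (hν_nonneg : ∀ᵐ v ∂ν, 0 ≤ v)
    (hν_mgf : ∃ θ : ℝ, 0 < θ ∧ θ ∈ integrableExpSet id ν)
    (V : GRR.Packet η → Ω → ℝ) (hV_meas : ∀ q, Measurable (V q))
    (hV_law : ∀ q, P.map (V q) = ν) (hV_indep : iIndepFun V P)
    -- the packet `(g, i, k)` and the threshold
    (g : Fin η) (i k : ℕ) (hi : 1 ≤ i) (hk : 1 ≤ k) (x : ℝ) (hx : 0 < x) :
    -- `m_{g,i}(k)` tends to the value that enters `γ(x, k, ∞)`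
    Tendsto (GRR.roundRatio d α (g, i, k)) (GRR.manySources α)
      (𝓝 (GRR.limitRatio d α (g, i, k))) ∧
    -- lower bound on the decay rate
    (⨅ l ∈ Finset.Icc 0 (GRR.lastIter d (g, i, k)),
        GRR.gammaU ν d α b g (GRR.limitRatio d α (g, i, k)) x l)
      ≤ liminf (GRR.decayRate P V d α b (g, i, k) x) (GRR.manySources α) ∧
    -- upper bound on the decay rate (hence on the limit, whenever it exists)
    liminf (GRR.decayRate P V d α b (g, i, k) x) (GRR.manySources α)
      ≤ (⨅ l ∈ Finset.Icc 0 (GRR.lastIter d (g, i, k)),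
        GRR.gammaL ν d α b g (GRR.limitRatio d α (g, i, k)) x l) ∧
    -- the upper bound holds for the upper limit too, for the first group if the tail of `ν`
    -- has an exponential decay rate in `[0, ∞]`
    ((g = 0 → ∃ R : EReal,
        Tendsto (fun t : ℝ => -(ENNReal.log (ν (Set.Ici t)) / (t : EReal))) atTop (𝓝 R)) →
      limsup (GRR.decayRate P V d α b (g, i, k) x) (GRR.manySources α)
        ≤ (⨅ l ∈ Finset.Icc 0 (GRR.lastIter d (g, i, k)),
          GRR.gammaL ν d α b g (GRR.limitRatio d α (g, i, k)) x l)) := by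
  have hd : ∀ j, 0 < d j := fun j => by
    have := hd_mono.monotone (Fin.zero_le j)
    lia
  have hne := GRR.manySources_neBot hα_pos
  -- For l ≥ 1 at least one full round precedes that of the packet, so the number of terms is of
  -- order `n` and Cramér's bound applies.
  have hpositive : ∀ l ∈ Finset.Icc 1 (GRR.lastIter d (g, i, k)),
      limsup (GRR.decayRate P V d α b (g, i, k) x) (GRR.manySources α) ≤
        GRR.gammaL ν d α b g (GRR.limitRatio d α (g, i, k)) x l := by
    intro l hl
    obtain ⟨hl1, hl2⟩ := Finset.mem_Icc.1 hl
    obtain ⟨r, hr, hle⟩ := GRR.exists_le_gammaL hν_nonneg hα_pos hd hb (g, i, k)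
      (GRR.limitRatio d α (g, i, k)) x hl1 hl2
    exact (GRR.limsup_decayRate_le_rateFunction hν_nonneg hν_mgf hα_pos hd hd_first hV_meas hV_law
      hV_indep hi hk hr.le (add_pos_of_pos_of_nonneg (GRR.loadFrom_pos hα_pos hd_first hr)
        (GRR.limitRatio_nonneg hα_pos _))).trans hle
  -- Beyond the first group, group `0`, which has period 1, is served earlier in the same round, so
  -- m > 0 and Cramér's bound applies even to a single round.
  have hzero : g ≠ 0 → limsup (GRR.decayRate P V d α b (g, i, k) x) (GRR.manySources α) ≤
      GRR.gammaL ν d α b g (GRR.limitRatio d α (g, i, k)) x 0 := by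
    intro hg
    have h := GRR.limsup_decayRate_le_rateFunction (b := b) (x := x) hν_nonneg hν_mgf hα_pos hd
      hd_first hV_meas hV_law hV_indep hi hk (le_refl (GRR.roundOf d (g, i, k)))
      (by simpa [GRR.loadFrom] using GRR.limitRatio_pos hα_pos hd_first (p := (g, i, k)) hg)
    simpa [GRR.gammaL, GRR.loadFrom, GRR.ageLevel] using h
  have htail := GRR.eventually_decayRate_le_tail (b := b) (x := x) (g := g) (i := i) hν_nonneg
    hα_pos hd_first hV_meas hV_law hk
  -- Here m = 0, and only the single-packet tail is available.
  have hgamma : g = 0 → GRR.gammaL ν d α b g (GRR.limitRatio d α (g, i, k)) x 0 =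
      GRR.rateFunction ν 0 (x - d g * b) := by
    intro hg
    rw [GRR.limitRatio_of_eq_zero (p := (g, i, k)) hg]
    simp [GRR.gammaL]
  refine ⟨GRR.tendsto_roundRatio hα_pos hd hi hk,
    GRR.iInf_gammaU_le_liminf_decayRate hν_nonneg hα_pos hd hb hV_meas hV_law hV_indep hi hk,
    le_iInf₂ fun l hl => ?_, fun hlim => le_iInf₂ fun l hl => ?_⟩
  · rcases Nat.eq_zero_or_pos l with rfl | hl0
    · by_cases hg : g = 0
      · rw [hgamma hg]
        refine (liminf_le_liminf htail).trans ?_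
        rcases le_or_gt (x - d g * b) 0 with hy | hy
        · exact (liminf_le_limsup).trans (limsup_le_of_le (by isBoundedDefault)
            (Eventually.of_forall (GRR.neg_log_tail_div_le_rateFunction hν_nonneg hν_mgf hy)))
        · exact GRR.liminf_tail_le_rateFunction hν_nonneg hν_mgf hα_pos hy
      · exact (liminf_le_limsup).trans (hzero hg)
    · exact (liminf_le_limsup).trans
        (hpositive l (Finset.mem_Icc.2 ⟨hl0, (Finset.mem_Icc.1 hl).2⟩))
  · rcases Nat.eq_zero_or_pos l with rfl | hl0
    · by_cases hg : g = 0
      · rw [hgamma hg]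
        refine (limsup_le_limsup htail).trans ?_
        rcases le_or_gt (x - d g * b) 0 with hy | hy
        · exact limsup_le_of_le (by isBoundedDefault)
            (Eventually.of_forall (GRR.neg_log_tail_div_le_rateFunction hν_nonneg hν_mgf hy))
        · obtain ⟨R, hR⟩ := hlim hg
          exact GRR.limsup_tail_le_rateFunction hν_nonneg hν_mgf hR hy
      · exact hzero hg
    · exact hpositive l (Finset.mem_Icc.2 ⟨hl0, (Finset.mem_Icc.1 hl).2⟩)
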